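/- Let $d,m\ge 0$, $\sigma>0$, $\sigma_n>0$, and let $k(s,s')=\exp\bigl(-\|s-s'\|^2/(2\sigma^2)\bigr)$ on $\mathbb R^d$. Let $\mathcal H_k$ be the reproducing kernel Hilbert space of $\mathbb R^m$-valued functions on $\mathbb R^d$ with kernel $k(s,s')I_m$ (so $\|H\|^2_{\mathcal H_k}$ is the sum of the squared scalar RKHS norms of the $m$ coordinates of $H$). Let $(\delta s_t,\delta r_t)_{t\ge1}$ be independent, identically distributed random pairs in $\mathbb R^d\times\mathbb R^m$ with law $\mu$, where $\mathbb E\|\delta r_1\|^2<\infty$; let $\rho$ be the law of $\delta s_1$, and let $\eta(\delta s)=\mathbb E[\delta r\mid\delta s]$ be (a measurable version of) the regression function. For training inputs $S=(s_1,\dots,s_N)$, outputs $Y=(y_1,\dots,y_N)$ and a linear map $W:\mathbb R^d\to\mathbb R^m$ put $$H_{S,Y}(s)=k(S,s)^{T}\,[K(S,S)+\sigma_n^2 I]^{-1}\,Y,\qquad \mu^W_{S,Y}(s)=Ws+H_{S,\,Y-WS}(s),$$ where $k(S,s)=(k(s_i,s))_i$, $K(S,S)=(k(s_i,s_j))_{ij}$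 and $Y-WS=(y_i-Ws_i)_i$. Thus $\mu^W_{S,Y}$ is the Gaussian process regression (GPR) prediction with linear prior mean $W$, and $H_{S,Y}$ is its kernel term (the prediction for $W=0$). Let $$J_{S,Y}[H]=\tfrac12\|H\|_{\mathcal H_k}^2+\tfrac1{2\sigma_n^2}\sum_{t=1}^N\|y_t-H(s_t)\|^2 ,\qquad H\in\mathcal H_k .$$ Write $S_N=(\delta s_1,\dots,\delta s_N)$ and $R_N=(\delta r_1,\dots,\delta r_N)$. Then: 1. For all $N$ and all data $S,Y$, the function $H_{S,Y}$ belongs to $\mathcal H_k$ and is the unique minimizer of $J_{S,Y}$ over $\mathcal H_k$. 2. The GPR estimate converges to the regression function in mean square: $$\lim_{N\to\infty}\mathbb E\int\|H_{S_N,R_N}(s)-\eta(s)\|^2\,d\rho(s)=0 .$$ 3. If moreover $\mathbb E\|\delta s_1\|^2<\infty$, then for every $C$ $$\lim_{N\to\infty}\mathbb E\,\sup_{\|W\|\le C}\int\|\mu^W_{S_N,R_N}(s)-\eta(s)\|^2\,d\rho(s)=0 ,$$ so the full GPR prediction converges to $\eta$ for every bounded, possibly data-dependent, choice of the linear prior mean.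 4. For every $N$ the expected functional $H\mapsto\mathbb E\,J_{S_N,R_N}[H]$ has a unique minimizer $\bar H_N\in\mathcal H_k$. For $N\ge1$, whenever $\varphi\in L^2(\rho)$ satisfies $\int k(s,s')\varphi(s')\,d\rho(s')=\lambda\varphi(s)$ for $\rho$-almost every $s$, $$\int\varphi\,\bar H_N\,d\rho=\frac{\lambda}{\lambda+\sigma_n^2/N}\int\varphi\,\eta\,d\rho ,$$ and $\bar H_N\to\eta$ in $L^2(\rho)$ as $N\to\infty$. -/

import Mathlib

open MeasureTheory ProbabilityTheory Filter Topology
open scoped ENNReal Matrix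

/-- `Vec d` is `ℝᵈ` with its Euclidean norm. -/
abbrev Vec (d : ℕ) : Type := EuclideanSpace ℝ (Fin d)

/-- The radial basis function kernel `k(s, s') = exp(-‖s - s'‖² / (2 σ²))` with spread `σ`. -/
noncomputable def rbfKernel {d : ℕ} (σ : ℝ) (s s' : Vec d) : ℝ :=
  Real.exp (-(‖s - s'‖ ^ 2 / (2 * σ ^ 2)))

/-- The Gram matrix `A = K(S, S) + σₙ² I` of the training inputs `S₁, …, S_N`. -/
noncomputable def gprGram {d N : ℕ} (σ σn : ℝ) (S : Fin N → Vec d) :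
    Matrix (Fin N) (Fin N) ℝ :=
  Matrix.of (fun i j => rbfKernel σ (S i) (S j)) + σn ^ 2 • (1 : Matrix (Fin N) (Fin N) ℝ)

/-- The kernel term `kᵀ(S, s) [K(S, S) + σₙ² I]⁻¹ Y` of the Gaussian process regression prediction
at `s`, for training inputs `S₁, …, S_N` and (vector-valued) training outputs `Y₁, …, Y_N`. -/
noncomputable def gprTerm {d m N : ℕ} (σ σn : ℝ) (S : Fin N → Vec d) (Y : Fin N → Vec m)
    (s : Vec d) : Vec m :=
  ∑ i, ((fun j => rbfKernel σ (S j) s) ᵥ* (gprGram σ σn S)⁻¹) i • Y i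

/-- The Gaussian process regression posterior mean
`μ(s) = W s + kᵀ(S, s) [K(S, S) + σₙ² I]⁻¹ (R - W S)` with linear prior mean `W`. -/
noncomputable def gprMean {d m N : ℕ} (σ σn : ℝ) (W : Vec d →L[ℝ] Vec m)
    (S : Fin N → Vec d) (R : Fin N → Vec m) (s : Vec d) : Vec m :=
  W s + gprTerm σ σn S (fun i => R i - W (S i)) s

/-- The kernel `k(s, s') I` acting on `ℝᵐ`: one copy of the RBF kernel for each output
coordinate. -/
noncomputable def rbfOpKernel (d m : ℕ) (σ : ℝ) :
    Matrix (Vec d) (Vec d) (Vec m →L[ℝ] Vec m) :=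
  Matrix.of fun s s' => rbfKernel σ s s' • ContinuousLinearMap.id ℝ (Vec m)

theorem rbfKernel_comm {d : ℕ} (σ : ℝ) (s s' : Vec d) : rbfKernel σ s s' = rbfKernel σ s' s := by
  simp [rbfKernel, norm_sub_rev s s']

/-- The RBF kernel is the Fourier transform of a Gaussian. -/
theorem rbfKernel_eq_charFun {d : ℕ} (σ : ℝ) (s s' : Vec d) :
    ((rbfKernel σ s s' : ℝ) : ℂ) = charFun (stdGaussian (Vec d)) (σ⁻¹ • (s - s')) := by
  rw [charFun_stdGaussian]
  simp only [rbfKernel, norm_smul, norm_inv, Real.norm_eq_abs]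
  push_cast
  congr 1
  have h : ((|σ| : ℝ) : ℂ) ^ 2 = (σ : ℂ) ^ 2 := by
    rw [← Complex.ofReal_pow, sq_abs, Complex.ofReal_pow]
  rw [mul_pow, inv_pow, h]
  ring

theorem rbfKernel_sum_nonneg {d : ℕ} (σ : ℝ) (t : Finset (Vec d)) (c : Vec d → ℝ) :
    0 ≤ ∑ x ∈ t, ∑ y ∈ t, c x * c y * rbfKernel σ x y := by
  let e : Vec d → Vec d → ℂ := fun x z => Complex.exp ((inner ℝ z (σ⁻¹ • x) : ℝ) * Complex.I)
  have hcont : ∀ x, Continuous (e x) := fun x => by fun_prop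
  have hnorm : ∀ x z, ‖e x z‖ = 1 := fun x z => Complex.norm_exp_ofReal_mul_I _
  have key : ∀ x y z, e x z * (starRingEnd ℂ) (e y z)
      = Complex.exp ((inner ℝ z (σ⁻¹ • (x - y)) : ℝ) * Complex.I) := by
    intro x y z
    simp only [e, ← Complex.exp_conj, ← Complex.exp_add, map_mul, Complex.conj_ofReal,
      Complex.conj_I, smul_sub, inner_sub_right]
    push_cast
    ring_nf
  have hint : ∀ x y, Integrable (fun z => e x z * (starRingEnd ℂ) (e y z))
      (stdGaussian (Vec d)) := by
    intro x y
    refine Integrable.of_bound (C := 1) ?_ ?_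
    · exact ((hcont x).mul (Complex.continuous_conj.comp (hcont y))).aestronglyMeasurable
    · exact ae_of_all _ fun z => by simp [hnorm]
  have h1 : ((∑ x ∈ t, ∑ y ∈ t, c x * c y * rbfKernel σ x y : ℝ) : ℂ)
      = ((∫ z, ‖∑ x ∈ t, (c x : ℂ) * e x z‖ ^ 2 ∂(stdGaussian (Vec d)) : ℝ) : ℂ) := by
    rw [← integral_complex_ofReal]
    have h2 : ∀ z, ((‖∑ x ∈ t, (c x : ℂ) * e x z‖ ^ 2 : ℝ) : ℂ)
        = ∑ x ∈ t, ∑ y ∈ t, ((c x : ℂ) * c y) * (e x z * (starRingEnd ℂ) (e y z)) := by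
      intro z
      rw [Complex.ofReal_pow, ← Complex.mul_conj', map_sum, Finset.sum_mul_sum]
      refine Finset.sum_congr rfl fun x _ => Finset.sum_congr rfl fun y _ => ?_
      rw [map_mul, Complex.conj_ofReal]
      ring
    simp_rw [h2]
    rw [integral_finsetSum _ fun x _ => integrable_finsetSum _ fun y _ => (hint x y).const_mul _]
    push_cast
    refine Finset.sum_congr rfl fun x _ => ?_
    rw [integral_finsetSum _ fun y _ => (hint x y).const_mul _]
    refine Finset.sum_congr rfl fun y _ => ?_
    rw [integral_const_mul, rbfKernel_eq_charFun, charFun_apply]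
    simp_rw [key]
  have h3 := Complex.ofReal_injective h1
  rw [h3]
  positivity

theorem rbfOpKernel_posSemidef (d m : ℕ) (σ : ℝ) : (rbfOpKernel d m σ).PosSemidef := by
  have tfae := RKHS.posSemidef_tfae (𝕜 := ℝ) (K := rbfOpKernel d m σ)
  suffices h0 : (rbfOpKernel d m σ).IsHermitian ∧ ∀ vv : Vec d →₀ Vec m,
      0 ≤ RCLike.re (vv.sum fun x w ↦ vv.sum fun x' w' ↦
        (inner ℝ (rbfOpKernel d m σ x' x w) w' : ℝ)) from (tfae.out 0 2).mpr h0
  refine ⟨?_, fun vv => ?_⟩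
  · ext1 x y
    have h1 : star (ContinuousLinearMap.id ℝ (Vec m)) = ContinuousLinearMap.id ℝ (Vec m) :=
      star_one (Vec m →L[ℝ] Vec m)
    simp [rbfOpKernel, rbfKernel_comm σ x y, star_smul, h1]
  · have h : RCLike.re (vv.sum fun x w ↦ vv.sum fun x' w' ↦
        (inner ℝ (rbfOpKernel d m σ x' x w) w' : ℝ))
        = ∑ l : Fin m, ∑ x ∈ vv.support, ∑ y ∈ vv.support,
            vv x l * vv y l * rbfKernel σ x y := by
      simp only [Finsupp.sum, RCLike.re_to_real]
      conv_rhs => rw [Finset.sum_comm]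
      refine Finset.sum_congr rfl fun x _ => ?_
      conv_rhs => rw [Finset.sum_comm]
      refine Finset.sum_congr rfl fun y _ => ?_
      simp only [rbfOpKernel, Matrix.of_apply, FunLike.coe_smul, Pi.smul_apply,
        ContinuousLinearMap.id_apply, inner_smul_left, PiLp.inner_apply, Finset.mul_sum]
      refine Finset.sum_congr rfl fun l _ => ?_
      simp [rbfKernel_comm σ x y]
      ring
    rw [h]
    exact Finset.sum_nonneg fun l _ => rbfKernel_sum_nonneg σ _ fun x => vv x l

instance rbfOpKernel_fact (d m : ℕ) (σ : ℝ) : Fact (rbfOpKernel d m σ).PosSemidef :=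
  ⟨rbfOpKernel_posSemidef d m σ⟩

/-- The reproducing kernel Hilbert space of `ℝᵐ`-valued functions on `ℝᵈ` with the RBF kernel; its
squared norm is the sum of the squared scalar RKHS norms of the coordinates. -/
abbrev RBFSpace (d m : ℕ) (σ : ℝ) : Type := RKHS.OfKernel (rbfOpKernel d m σ)

/-- The regularized functional `J[H] = ½ ‖H‖² + 1/(2 σₙ²) ∑ₜ ‖Rₜ - H(Sₜ)‖²`. -/
noncomputable def gprFunctional {d m N : ℕ} {σ : ℝ} (σn : ℝ) (S : Fin N → Vec d)
    (R : Fin N → Vec m) (H : RBFSpace d m σ) : ℝ :=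
  1 / 2 * ‖H‖ ^ 2 + 1 / (2 * σn ^ 2) * ∑ t, ‖R t - H (S t)‖ ^ 2

/-- `H` is the unique minimizer of `J`. -/
def IsUniqueMinimizer {α : Type*} (J : α → ℝ) (H : α) : Prop :=
  ∀ H', H' ≠ H → J H < J H'

/-!
Consistency of Gaussian process regression rests on identities for the Gram matrix
`A = K(S, S) + σₙ² I`, on exchangeability of the sample, and on density of the RKHS in `L²(ρ)`.

*Leave-one-out.* For `N + 1` points `S₀, …, S_N`, the column of `A⁻¹` belonging to `S₀` consists, up
to the predictive variance `c ∈ [σₙ², 1 + σₙ²]` at `S₀`, of the weights `a` of the prediction at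
`S₀` from the other points (`gprVariance_mul_gprGram_inv`). Hence the prediction error at `S₀` is
`c` times the coefficient `(A⁻¹ Y)₀` (`sub_gprTerm_tail`), and `σₙ² A⁻¹ Y` are the training
residuals. As the points are exchangeable, the expected squared test error of noise-free outputs
`u(s)` is at most a constant times the mean squared training error, which by optimality of the
prediction is at most `σₙ² ‖g‖² / (N + 1) + ‖u - g‖²_{L²(ρ)}` for every `g` in the RKHS
(`lintegral_noiseless_error_le`).

*Density.* If `f ∈ L²(ρ)` is orthogonal to the RKHS, then the convolution of `f ρ` with a Gaussian
vanishes; the Fourier transform of a Gaussian has no zeros, so that of `f ρ` vanishes and `f = 0`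
(`rbfToLp_range_dense`). Therefore the noise-free error tends to zero (`tendsto_noiseless_error`).

*Noise.* The noise `ξ = r - η(s)` contributes `∑ aᵢ ξᵢ` to the prediction. Its terms are
uncorrelated, and exchanging the test point with the `i`-th training point bounds the mean square of
the sum by a constant times `E[‖ξ₀‖² |a|²]` (`lintegral_noise_le`). No bound on the conditional
variance of the noise is needed, because now `ξ₀` is attached to the test point while `a` depends on
the inputs only. Moreover `σₙ² |a|²` is at most the posterior variance, which tends to zero at every
point to whose neighbourhoods the sample returns infinitely often (`tendsto_gprWeight_sq`), that is,
almost everywhere. Dominated convergence concludes (`tendsto_noise`).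

For a linear prior mean `W`, the additional error is `W` applied to the noise-free error of the
identity function `s ↦ s`, which gives uniformity over bounded `W` (`tendsto_gprMean_regression`).

The expected functional is, up to an additive constant, the Tikhonov functional
`½ ‖H‖² + N / (2 σₙ²) ‖H - η‖²_{L²(ρ)}` (`integral_gprFunctional`, `integral_risk_eq`). Its
minimizer comes from the Lax–Milgram theorem (`exists_tikhonov_normal_equation`). Testing the
normal equation with the image of an eigenfunction under the adjoint of the inclusion into `L²(ρ)`
yields the formula for the coefficients (`integral_eigenfunction_minimizer`), and
comparison with a fixed element of the RKHS close to `η` yields convergence (`tendsto_minimizer_error`).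
-/

/-! ### The RBF kernel and its reproducing kernel Hilbert space -/

section Kernel

variable {d m : ℕ} {σ : ℝ}

@[simp]
theorem rbfKernel_self (s : Vec d) : rbfKernel σ s s = 1 := by simp [rbfKernel]

theorem rbfKernel_nonneg (s s' : Vec d) : 0 ≤ rbfKernel σ s s' := (Real.exp_pos _).le

theorem rbfKernel_le_one (s s' : Vec d) : rbfKernel σ s s' ≤ 1 := by
  rw [rbfKernel, Real.exp_le_one_iff]
  have : 0 ≤ ‖s - s'‖ ^ 2 / (2 * σ ^ 2) := by positivity
  linarith

@[fun_prop]
theorem Continuous.rbfKernel {X : Type*} [TopologicalSpace X] {f g : X → Vec d}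
    (hf : Continuous f) (hg : Continuous g) : Continuous fun x => rbfKernel σ (f x) (g x) := by
  unfold _root_.rbfKernel
  fun_prop

theorem rbfSpace_kerFun_apply (x y : Vec d) (v : Vec m) :
    RKHS.kerFun (RBFSpace d m σ) y v x = rbfKernel σ x y • v := by
  rw [RKHS.kerFun_apply, RKHS.OfKernel.kernel_ofKernel]
  simp [rbfOpKernel]

theorem inner_kerFun_kerFun (x y : Vec d) (v w : Vec m) :
    inner ℝ (RKHS.kerFun (RBFSpace d m σ) x v) (RKHS.kerFun (RBFSpace d m σ) y w)
      = rbfKernel σ x y * inner ℝ v w := by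
  rw [RKHS.kerFun_inner, rbfSpace_kerFun_apply, inner_smul_right]

/-- The factor is the RKHS norm of `k(·, x) v - k(·, y) v` for a unit vector `v`. -/
theorem norm_rbfSpace_apply_sub_le (H : RBFSpace d m σ) (x y : Vec d) :
    ‖H x - H y‖ ≤ √(2 - 2 * rbfKernel σ x y) * ‖H‖ := by
  set v := H x - H y with hv
  set G := RKHS.kerFun (RBFSpace d m σ) x v - RKHS.kerFun (RBFSpace d m σ) y v with hG
  have hk := rbfKernel_le_one (σ := σ) x y
  have h1 : ‖v‖ ^ 2 = inner ℝ G H := by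
    rw [hG, inner_sub_left, RKHS.kerFun_inner, RKHS.kerFun_inner, ← inner_sub_right,
      ← hv, real_inner_self_eq_norm_sq]
  have h2 : ‖G‖ = √(2 - 2 * rbfKernel σ x y) * ‖v‖ := by
    rw [← Real.sqrt_sq (norm_nonneg G), ← Real.sqrt_sq (norm_nonneg v),
      ← Real.sqrt_mul (by linarith)]
    congr 1
    rw [← real_inner_self_eq_norm_sq, hG]
    rw [real_inner_sub_sub_self, inner_kerFun_kerFun, inner_kerFun_kerFun, inner_kerFun_kerFun,
      rbfKernel_self, rbfKernel_self, real_inner_self_eq_norm_sq]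
    ring
  have h3 := real_inner_le_norm G H
  rw [← h1, h2] at h3
  rcases eq_or_ne ‖v‖ 0 with h0 | h0
  · rw [h0]; positivity
  · have : 0 < ‖v‖ := lt_of_le_of_ne (norm_nonneg _) h0.symm
    nlinarith

theorem norm_rbfSpace_apply_le (H : RBFSpace d m σ) (x : Vec d) : ‖H x‖ ≤ ‖H‖ := by
  have h1 : ‖H x‖ ^ 2 ≤ ‖RKHS.kerFun (RBFSpace d m σ) x (H x)‖ * ‖H‖ := by
    rw [← real_inner_self_eq_norm_sq, ← RKHS.kerFun_inner]
    exact real_inner_le_norm _ _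
  have h2 : ‖RKHS.kerFun (RBFSpace d m σ) x (H x)‖ = ‖H x‖ := by
    rw [← sq_eq_sq₀ (norm_nonneg _) (norm_nonneg _), ← real_inner_self_eq_norm_sq,
      inner_kerFun_kerFun, rbfKernel_self, one_mul, real_inner_self_eq_norm_sq]
  rw [h2] at h1
  rcases eq_or_ne ‖H x‖ 0 with h0 | h0
  · rw [h0]; positivity
  · have : 0 < ‖H x‖ := lt_of_le_of_ne (norm_nonneg _) h0.symm
    nlinarith

theorem continuous_rbfSpace (H : RBFSpace d m σ) : Continuous fun x => H x := by
  rw [continuous_iff_continuousAt]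
  intro y
  rw [ContinuousAt, tendsto_iff_norm_sub_tendsto_zero]
  have h : Tendsto (fun x => √(2 - 2 * rbfKernel σ x y) * ‖H‖) (𝓝 y) (𝓝 0) := by
    have hc : Continuous fun x => √(2 - 2 * rbfKernel σ x y) * ‖H‖ := by fun_prop
    simpa using hc.tendsto y
  exact squeeze_zero (fun x => norm_nonneg _) (fun x => norm_rbfSpace_apply_sub_le H x y) h

theorem rbfSpace_memLp (ρ : Measure (Vec d)) [IsFiniteMeasure ρ] (H : RBFSpace d m σ) :
    MemLp (fun x => H x) 2 ρ :=
  MemLp.of_bound (continuous_rbfSpace H).aestronglyMeasurable ‖H‖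
    (ae_of_all _ (norm_rbfSpace_apply_le H))

/-- The expression on the right is the squared RKHS norm of `k(·, s) - ∑ᵢ bᵢ k(·, Sᵢ)`. -/
theorem rbfKernel_residual_nonneg {N : ℕ} (S : Fin N → Vec d) (s : Vec d) (b : Fin N → ℝ) :
    0 ≤ 1 - 2 * ∑ i, b i * rbfKernel σ (S i) s
      + ∑ i, b i * ∑ j, rbfKernel σ (S i) (S j) * b j := by
  let e : Vec 1 := EuclideanSpace.single 0 1
  have he : inner ℝ e e = (1 : ℝ) := by simp [e]
  let κ : Vec d → RBFSpace d 1 σ := fun x => RKHS.kerFun (RBFSpace d 1 σ) x e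
  have hκ : ∀ x y, inner ℝ (κ x) (κ y) = rbfKernel σ x y := fun x y => by
    simp only [κ]; rw [inner_kerFun_kerFun, he, mul_one]
  have h := real_inner_self_nonneg (x := κ s - ∑ i, b i • κ (S i))
  convert h using 1
  simp only [real_inner_sub_sub_self, sum_inner, inner_sum, inner_smul_left,
    inner_smul_right, hκ, rbfKernel_self, rbfKernel_comm σ s, Finset.mul_sum, conj_trivial]
  congr 1
  rw [Finset.sum_comm]
  refine Finset.sum_congr rfl fun i _ => Finset.sum_congr rfl fun j _ => ?_
  rw [rbfKernel_comm]; ring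

/-- The expression on the right is the squared RKHS norm of `∑ᵢ bᵢ k(·, Sᵢ)`. -/
theorem rbfKernel_quadratic_nonneg {N : ℕ} (S : Fin N → Vec d) (b : Fin N → ℝ) :
    0 ≤ ∑ i, b i * ∑ j, rbfKernel σ (S i) (S j) * b j := by
  let e : Vec 1 := EuclideanSpace.single 0 1
  have he : inner ℝ e e = (1 : ℝ) := by simp [e]
  let κ : Vec d → RBFSpace d 1 σ := fun x => RKHS.kerFun (RBFSpace d 1 σ) x e
  have hκ : ∀ x y, inner ℝ (κ x) (κ y) = rbfKernel σ x y := fun x y => by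
    simp only [κ]; rw [inner_kerFun_kerFun, he, mul_one]
  have h := real_inner_self_nonneg (x := ∑ i, b i • κ (S i))
  convert h using 1
  simp only [sum_inner, inner_sum, inner_smul_left, inner_smul_right, hκ, Finset.mul_sum,
    conj_trivial]
  rw [Finset.sum_comm]
  refine Finset.sum_congr rfl fun i _ => Finset.sum_congr rfl fun j _ => ?_
  rw [rbfKernel_comm]; ring

end Kernel

/-! ### The Gram matrix and the prediction weights -/

section Gram

variable {d m N : ℕ} {σ σn : ℝ}

theorem gprGram_mulVec (S : Fin N → Vec d) (x : Fin N → ℝ) (i : Fin N) :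
    (gprGram σ σn S *ᵥ x) i = ∑ j, rbfKernel σ (S i) (S j) * x j + σn ^ 2 * x i := by
  rw [gprGram, Matrix.add_mulVec, Matrix.smul_mulVec, Matrix.one_mulVec]
  simp [Matrix.mulVec, dotProduct]

theorem dotProduct_gprGram_mulVec (S : Fin N → Vec d) (x : Fin N → ℝ) :
    x ⬝ᵥ gprGram σ σn S *ᵥ x =
      ∑ i, x i * ∑ j, rbfKernel σ (S i) (S j) * x j + σn ^ 2 * (x ⬝ᵥ x) := by
  simp only [dotProduct, gprGram_mulVec, Finset.mul_sum, mul_add, Finset.sum_add_distrib]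
  congr 1
  exact Finset.sum_congr rfl fun i _ => by ring

theorem gprGram_coercive (S : Fin N → Vec d) (x : Fin N → ℝ) :
    σn ^ 2 * (x ⬝ᵥ x) ≤ x ⬝ᵥ gprGram σ σn S *ᵥ x := by
  rw [dotProduct_gprGram_mulVec]
  linarith [rbfKernel_quadratic_nonneg (σ := σ) S x]

theorem gprGram_transpose (S : Fin N → Vec d) : (gprGram σ σn S)ᵀ = gprGram σ σn S := by
  ext i j
  simp [gprGram, Matrix.transpose_apply, rbfKernel_comm σ (S i) (S j), Matrix.one_apply, eq_comm]

theorem gprGram_inv_transpose (S : Fin N → Vec d) :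
    ((gprGram σ σn S)⁻¹)ᵀ = (gprGram σ σn S)⁻¹ := by
  rw [Matrix.transpose_nonsing_inv, gprGram_transpose]

theorem gprGram_inv_comm (S : Fin N → Vec d) (i j : Fin N) :
    (gprGram σ σn S)⁻¹ i j = (gprGram σ σn S)⁻¹ j i := by
  conv_lhs => rw [← gprGram_inv_transpose, Matrix.transpose_apply]

theorem dotProduct_self_nonneg_of_real (x : Fin N → ℝ) : 0 ≤ x ⬝ᵥ x :=
  Finset.sum_nonneg fun i _ => mul_self_nonneg (x i)

theorem isUnit_gprGram (hσn : 0 < σn) (S : Fin N → Vec d) : IsUnit (gprGram σ σn S) := by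
  rw [← Matrix.mulVec_injective_iff_isUnit]
  rw [← Matrix.coe_mulVecLin, ← LinearMap.ker_eq_bot, LinearMap.ker_eq_bot']
  intro x hx
  rw [Matrix.mulVecLin_apply] at hx
  have h := gprGram_coercive (σ := σ) (σn := σn) S x
  rw [hx, dotProduct_zero] at h
  have h0 : x ⬝ᵥ x ≤ 0 := by
    by_contra! hc
    nlinarith [pow_pos hσn 2]
  exact dotProduct_self_eq_zero.mp (le_antisymm h0 (dotProduct_self_nonneg_of_real x))

theorem isUnit_det_gprGram (hσn : 0 < σn) (S : Fin N → Vec d) : IsUnit (gprGram σ σn S).det :=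
  (Matrix.isUnit_iff_isUnit_det _).mp (isUnit_gprGram hσn S)

/-- The weights `kᵀ(S, s) [K(S, S) + σₙ² I]⁻¹` with which the training outputs enter the kernel
term of the prediction at `s`. -/
noncomputable def gprWeight (σ σn : ℝ) (S : Fin N → Vec d) (s : Vec d) : Fin N → ℝ :=
  (fun j => rbfKernel σ (S j) s) ᵥ* (gprGram σ σn S)⁻¹

theorem gprTerm_eq_sum (S : Fin N → Vec d) (Y : Fin N → Vec m) (s : Vec d) :
    gprTerm σ σn S Y s = ∑ i, gprWeight σ σn S s i • Y i := rfl

theorem gprGram_mulVec_gprWeight (hσn : 0 < σn) (S : Fin N → Vec d) (s : Vec d) :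
    gprGram σ σn S *ᵥ gprWeight σ σn S s = fun j => rbfKernel σ (S j) s := by
  rw [gprWeight, ← Matrix.mulVec_transpose, gprGram_inv_transpose, Matrix.mulVec_mulVec,
    Matrix.mul_nonsing_inv _ (isUnit_det_gprGram hσn S), Matrix.one_mulVec]

/-- The weights are dominated by the posterior variance `1 - kᵀ a` at `s`. -/
theorem gprWeight_sq_le_variance (hσn : 0 < σn) (S : Fin N → Vec d) (s : Vec d) :
    σn ^ 2 * (gprWeight σ σn S s ⬝ᵥ gprWeight σ σn S s)
      ≤ 1 - ∑ i, gprWeight σ σn S s i * rbfKernel σ (S i) s := by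
  set a := gprWeight σ σn S s with ha
  have h1 := rbfKernel_residual_nonneg (σ := σ) S s a
  have h2 := dotProduct_gprGram_mulVec (σ := σ) (σn := σn) S a
  rw [gprGram_mulVec_gprWeight hσn S s] at h2
  simp only [dotProduct] at h2 ⊢
  linarith

/-- The posterior variance at `s` is the minimum over `b` of the regularized squared distance
between `k(·, s)` and `∑ᵢ bᵢ k(·, Sᵢ)`. -/
theorem variance_le (hσn : 0 < σn) (S : Fin N → Vec d) (s : Vec d) (b : Fin N → ℝ) :
    1 - ∑ i, gprWeight σ σn S s i * rbfKernel σ (S i) s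
      ≤ 1 - 2 * ∑ i, b i * rbfKernel σ (S i) s
        + ∑ i, b i * ∑ j, rbfKernel σ (S i) (S j) * b j + σn ^ 2 * (b ⬝ᵥ b) := by
  set a := gprWeight σ σn S s with ha
  have hA := gprGram_mulVec_gprWeight (σ := σ) hσn S s
  have h1 := gprGram_coercive (σ := σ) (σn := σn) S (b - a)
  have h2 := mul_nonneg (sq_nonneg σn) (dotProduct_self_nonneg_of_real (b - a))
  have h3 : (b - a) ⬝ᵥ gprGram σ σn S *ᵥ (b - a) = b ⬝ᵥ gprGram σ σn S *ᵥ b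
      - 2 * (b ⬝ᵥ fun j => rbfKernel σ (S j) s) + a ⬝ᵥ fun j => rbfKernel σ (S j) s := by
    have h4 : a ⬝ᵥ gprGram σ σn S *ᵥ b = b ⬝ᵥ fun j => rbfKernel σ (S j) s := by
      rw [← hA, Matrix.dotProduct_mulVec, ← Matrix.mulVec_transpose, gprGram_transpose,
        dotProduct_comm]
    rw [Matrix.mulVec_sub, hA, sub_dotProduct, dotProduct_sub, dotProduct_sub, h4]
    ring
  have h5 := dotProduct_gprGram_mulVec (σ := σ) (σn := σn) S b
  simp only [dotProduct] at h1 h2 h3 h5 ⊢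
  linarith

theorem gprWeight_sq_le (hσn : 0 < σn) (S : Fin N → Vec d) (s : Vec d) :
    gprWeight σ σn S s ⬝ᵥ gprWeight σ σn S s ≤ (σn ^ 2)⁻¹ := by
  have h1 := gprWeight_sq_le_variance (σ := σ) hσn S s
  have h2 := variance_le (σ := σ) hσn S s 0
  simp at h2
  rw [← one_div, le_div_iff₀ (by positivity)]
  linarith

theorem Continuous.gprGram_inv (hσn : 0 < σn) {X : Type*} [TopologicalSpace X]
    {S : X → Fin N → Vec d} (hS : ∀ i, Continuous fun x => S x i) (i j : Fin N) :
    Continuous fun x => (gprGram σ σn (S x))⁻¹ i j := by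
  have hA : Continuous fun x => gprGram σ σn (S x) := by
    unfold gprGram
    refine Continuous.add (continuous_matrix fun i j => ?_) continuous_const
    exact (hS i).rbfKernel (hS j)
  simp only [Matrix.inv_def, Ring.inverse_eq_inv', Matrix.smul_apply, smul_eq_mul]
  exact (hA.matrix_det.inv₀ fun x => (isUnit_det_gprGram hσn (S x)).ne_zero).mul
    (hA.matrix_adjugate.matrix_elem i j)

theorem Continuous.gprWeight (hσn : 0 < σn) {X : Type*} [TopologicalSpace X]
    {S : X → Fin N → Vec d} {s : X → Vec d} (hS : ∀ i, Continuous fun x => S x i)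
    (hs : Continuous s) (i : Fin N) :
    Continuous fun x => _root_.gprWeight σ σn (S x) (s x) i := by
  simp only [_root_.gprWeight, Matrix.vecMul, dotProduct]
  exact continuous_finsetSum _ fun j _ =>
    ((hS j).rbfKernel hs).mul (Continuous.gprGram_inv hσn hS j i)

end Gram

/-! ### Dual coefficients, optimality and leave-one-out identities -/

section Dual

variable {d m N : ℕ} {σ σn : ℝ}

/-- The coefficients `[K(S, S) + σₙ² I]⁻¹ Y` of the prediction in terms of the kernel functions at
the training inputs. -/
noncomputable def gprDual (σ σn : ℝ) (S : Fin N → Vec d) (Y : Fin N → Vec m) (i : Fin N) : Vec m :=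
  ∑ j, (gprGram σ σn S)⁻¹ i j • Y j

theorem gprTerm_eq_sum_dual (S : Fin N → Vec d) (Y : Fin N → Vec m) (s : Vec d) :
    gprTerm σ σn S Y s = ∑ j, rbfKernel σ (S j) s • gprDual σ σn S Y j := by
  simp only [gprTerm, gprDual, Matrix.vecMul, dotProduct, Finset.smul_sum, Finset.sum_smul,
    smul_smul]
  exact Finset.sum_comm

/-- The training residuals are `σₙ²` times the dual coefficients. -/
theorem sub_gprTerm_eq_dual (hσn : 0 < σn) (S : Fin N → Vec d) (Y : Fin N → Vec m) (i : Fin N) :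
    Y i - gprTerm σ σn S Y (S i) = σn ^ 2 • gprDual σ σn S Y i := by
  have h : ∑ j, gprGram σ σn S i j • gprDual σ σn S Y j = Y i := by
    have h1 : ∀ l, ∑ j, gprGram σ σn S i j * (gprGram σ σn S)⁻¹ j l
        = (1 : Matrix (Fin N) (Fin N) ℝ) i l := fun l => by
      rw [← Matrix.mul_nonsing_inv _ (isUnit_det_gprGram hσn S), Matrix.mul_apply]
    simp only [gprDual, Finset.smul_sum, smul_smul]
    rw [Finset.sum_comm]
    simp only [← Finset.sum_smul, h1, Matrix.one_apply, ite_smul, one_smul, zero_smul,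
      Finset.sum_ite_eq, Finset.mem_univ, if_true]
  have h2 : ∑ j, gprGram σ σn S i j • gprDual σ σn S Y j
      = gprTerm σ σn S Y (S i) + σn ^ 2 • gprDual σ σn S Y i := by
    rw [gprTerm_eq_sum_dual]
    simp only [gprGram, Matrix.add_apply, Matrix.of_apply, Matrix.smul_apply, Matrix.one_apply,
      add_smul, Finset.sum_add_distrib, smul_eq_mul, mul_ite, mul_one, mul_zero, ite_smul,
      zero_smul, Finset.sum_ite_eq, Finset.mem_univ, if_true]
    congr 1
    exact Finset.sum_congr rfl fun j _ => by rw [rbfKernel_comm]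
  rw [sub_eq_iff_eq_add', ← h2, h]

/-- The kernel term of the prediction as an element of the reproducing kernel Hilbert space. -/
noncomputable def gprFun (σ σn : ℝ) (S : Fin N → Vec d) (Y : Fin N → Vec m) : RBFSpace d m σ :=
  ∑ i, RKHS.kerFun (RBFSpace d m σ) (S i) (gprDual σ σn S Y i)

theorem inner_gprFun (S : Fin N → Vec d) (Y : Fin N → Vec m) (D : RBFSpace d m σ) :
    inner ℝ (gprFun σ σn S Y) D = ∑ i, inner ℝ (gprDual σ σn S Y i) (D (S i)) := by
  simp only [gprFun, sum_inner, RKHS.kerFun_inner]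

theorem gprFun_apply (S : Fin N → Vec d) (Y : Fin N → Vec m) (x : Vec d) :
    gprFun σ σn S Y x = gprTerm σ σn S Y x := by
  refine ext_inner_right ℝ fun w => ?_
  rw [← RKHS.inner_kerFun, inner_gprFun, gprTerm_eq_sum_dual, sum_inner]
  refine Finset.sum_congr rfl fun i _ => ?_
  rw [rbfSpace_kerFun_apply, inner_smul_left, inner_smul_right, conj_trivial]

/-- The functional is quadratic, and its first-order term at `gprFun` vanishes since the training
residuals there are `σₙ²` times the dual coefficients. -/
theorem gprFunctional_eq_add (hσn : 0 < σn) (S : Fin N → Vec d) (Y : Fin N → Vec m)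
    (G : RBFSpace d m σ) :
    gprFunctional σn S Y G = gprFunctional σn S Y (gprFun σ σn S Y)
      + 1 / 2 * ‖G - gprFun σ σn S Y‖ ^ 2
      + 1 / (2 * σn ^ 2) * ∑ i, ‖(G - gprFun σ σn S Y) (S i)‖ ^ 2 := by
  set H := gprFun σ σn S Y with hH
  obtain ⟨D, rfl⟩ : ∃ D, G = H + D := ⟨G - H, by abel⟩
  rw [add_sub_cancel_left]
  have h1 : ‖H + D‖ ^ 2 = ‖H‖ ^ 2 + 2 * ∑ i, inner ℝ (gprDual σ σn S Y i) (D (S i)) + ‖D‖ ^ 2 := by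
    rw [norm_add_sq_real, hH, inner_gprFun]
  have h2 : ∀ i, ‖Y i - (H + D) (S i)‖ ^ 2 = ‖Y i - H (S i)‖ ^ 2
      - 2 * σn ^ 2 * inner ℝ (gprDual σ σn S Y i) (D (S i)) + ‖D (S i)‖ ^ 2 := fun i => by
    rw [RKHS.coe_add, Pi.add_apply, ← sub_sub, norm_sub_sq_real, hH, gprFun_apply,
      sub_gprTerm_eq_dual hσn, inner_smul_left, conj_trivial]
    ring
  simp only [gprFunctional, h1, h2, Finset.sum_add_distrib, Finset.sum_sub_distrib,
    ← Finset.mul_sum]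
  field_simp
  ring

theorem gprFun_isUniqueMinimizer (hσn : 0 < σn) (S : Fin N → Vec d) (Y : Fin N → Vec m) :
    IsUniqueMinimizer (gprFunctional σn S Y) (gprFun σ σn S Y) := by
  intro G hG
  rw [gprFunctional_eq_add hσn S Y G]
  have h1 : 0 < ‖G - gprFun σ σn S Y‖ ^ 2 := by
    have := norm_pos_iff.mpr (sub_ne_zero.mpr hG)
    positivity
  have h2 : 0 ≤ 1 / (2 * σn ^ 2) * ∑ i, ‖(G - gprFun σ σn S Y) (S i)‖ ^ 2 := by positivity
  linarith

/-- The squared training residuals, written through the dual coefficients, are bounded by comparing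
the values of the functional at the minimizer and at a competitor `g`. -/
theorem sum_sq_dual_le (hσn : 0 < σn) (S : Fin N → Vec d) (Y : Fin N → Vec m)
    (g : RBFSpace d m σ) :
    σn ^ 4 * ∑ i, ‖gprDual σ σn S Y i‖ ^ 2
      ≤ σn ^ 2 * ‖g‖ ^ 2 + ∑ i, ‖Y i - g (S i)‖ ^ 2 := by
  have h1 : gprFunctional σn S Y (gprFun σ σn S Y) ≤ gprFunctional σn S Y g := by
    rw [gprFunctional_eq_add hσn S Y g]
    have : 0 ≤ 1 / 2 * ‖g - gprFun σ σn S Y‖ ^ 2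
      + 1 / (2 * σn ^ 2) * ∑ i, ‖(g - gprFun σ σn S Y) (S i)‖ ^ 2 := by positivity
    linarith
  have h2 : ∀ i, ‖Y i - gprFun σ σn S Y (S i)‖ ^ 2 = σn ^ 4 * ‖gprDual σ σn S Y i‖ ^ 2 := by
    intro i
    rw [gprFun_apply, sub_gprTerm_eq_dual hσn, norm_smul, Real.norm_of_nonneg (by positivity)]
    ring
  simp only [gprFunctional, h2, ← Finset.mul_sum] at h1
  field_simp at h1
  nlinarith [sq_nonneg ‖gprFun σ σn S Y‖, pow_pos hσn 2]

theorem gprGram_comp_perm (S : Fin N → Vec d) (π : Equiv.Perm (Fin N)) :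
    gprGram σ σn (S ∘ π) = (gprGram σ σn S).submatrix π π := by
  ext i j
  simp [gprGram, Matrix.one_apply]

theorem gprGram_inv_comp_perm (S : Fin N → Vec d) (π : Equiv.Perm (Fin N)) (i j : Fin N) :
    (gprGram σ σn (S ∘ π))⁻¹ i j = (gprGram σ σn S)⁻¹ (π i) (π j) := by
  rw [gprGram_comp_perm, Matrix.inv_submatrix_equiv, Matrix.submatrix_apply]

theorem gprDual_comp_perm (S : Fin N → Vec d) (Y : Fin N → Vec m) (π : Equiv.Perm (Fin N))
    (i : Fin N) : gprDual σ σn (S ∘ π) (Y ∘ π) i = gprDual σ σn S Y (π i) := by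
  simp only [gprDual, gprGram_inv_comp_perm, Function.comp_apply]
  exact Equiv.sum_comp π fun j => (gprGram σ σn S)⁻¹ (π i) j • Y j

/-- The predictive variance `1 + σₙ² - kᵀ [K(S, S) + σₙ² I]⁻¹ k` of a noisy output at `s`. -/
noncomputable def gprVariance (σ σn : ℝ) (S : Fin N → Vec d) (s : Vec d) : ℝ :=
  1 + σn ^ 2 - ∑ i, gprWeight σ σn S s i * rbfKernel σ (S i) s

theorem sq_le_gprVariance (hσn : 0 < σn) (S : Fin N → Vec d) (s : Vec d) :
    σn ^ 2 ≤ gprVariance σ σn S s := by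
  have h1 := gprWeight_sq_le_variance (σ := σ) hσn S s
  have h2 := mul_nonneg (sq_nonneg σn) (dotProduct_self_nonneg_of_real (gprWeight σ σn S s))
  rw [gprVariance]
  linarith

theorem gprVariance_le (hσn : 0 < σn) (S : Fin N → Vec d) (s : Vec d) :
    gprVariance σ σn S s ≤ 1 + σn ^ 2 := by
  have h := variance_le (σ := σ) hσn S s 0
  simp at h
  rw [gprVariance]
  linarith

/-- The column of the inverse Gram matrix of `S₀, …, S_N` that belongs to the point `S₀`: up to the
predictive variance `c` at `S₀` it consists of the weights of the prediction at `S₀` from the other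
points. -/
theorem gprVariance_mul_gprGram_inv (hσn : 0 < σn) (S : Fin (N + 1) → Vec d) (i : Fin (N + 1)) :
    gprVariance σ σn (Fin.tail S) (S 0) * (gprGram σ σn S)⁻¹ i 0
      = (Fin.cons 1 (-gprWeight σ σn (Fin.tail S) (S 0)) : Fin (N + 1) → ℝ) i := by
  set a := gprWeight σ σn (Fin.tail S) (S 0) with ha
  set c := gprVariance σ σn (Fin.tail S) (S 0) with hc
  -- the normal equations for `a` say that `A` maps `(1, -a)` to `c` times the first unit vector
  set x : Fin (N + 1) → ℝ := Fin.cons 1 (-a) with hx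
  have hAa := gprGram_mulVec_gprWeight (σ := σ) hσn (Fin.tail S) (S 0)
  have h : gprGram σ σn S *ᵥ x = c • Pi.single 0 1 := by
    ext i
    rw [gprGram_mulVec, Fin.sum_univ_succ]
    refine Fin.cases ?_ (fun i => ?_) i
    · simp only [hx, Fin.cons_zero, Fin.cons_succ, Pi.neg_apply, rbfKernel_self, Pi.smul_apply,
        Pi.single_eq_same, smul_eq_mul, mul_neg, Finset.sum_neg_distrib, hc, gprVariance, Fin.tail]
      simp only [← ha, mul_comm (a _), rbfKernel_comm σ (S 0)]
      ring_nf
    · have h1 := congrFun hAa i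
      rw [gprGram_mulVec] at h1
      simp only [Fin.tail] at h1
      simp only [hx, Fin.cons_zero, Fin.cons_succ, Pi.neg_apply, Pi.smul_apply, mul_neg,
        Finset.sum_neg_distrib, ← h1, ha, ne_eq, Fin.succ_ne_zero, not_false_eq_true,
        Pi.single_eq_of_ne, smul_zero]
      ring
  have h2 : x = (gprGram σ σn S)⁻¹ *ᵥ (c • Pi.single 0 1) := by
    rw [← h, Matrix.mulVec_mulVec, Matrix.nonsing_inv_mul _ (isUnit_det_gprGram hσn S),
      Matrix.one_mulVec]
  rw [h2, Matrix.mulVec_smul, Matrix.mulVec_single_one]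
  simp [Matrix.col]

/-- The leave-one-out error is the predictive variance times the dual coefficient. -/
theorem sub_gprTerm_tail (hσn : 0 < σn) (S : Fin (N + 1) → Vec d) (Y : Fin (N + 1) → Vec m) :
    Y 0 - gprTerm σ σn (Fin.tail S) (Fin.tail Y) (S 0)
      = gprVariance σ σn (Fin.tail S) (S 0) • gprDual σ σn S Y 0 := by
  rw [gprDual, Finset.smul_sum]
  simp only [smul_smul, gprGram_inv_comm S 0, gprVariance_mul_gprGram_inv hσn]
  rw [Fin.sum_univ_succ, gprTerm_eq_sum]
  simp [Fin.tail, sub_eq_add_neg]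

end Dual

/-! ### Exchangeable samples -/

section Sample

variable {X : Type*} [MeasurableSpace X] {N : ℕ}

/-- An i.i.d. sample is exchangeable. -/
theorem lintegral_pi_comp_perm (μ : Measure X) [SigmaFinite μ] (π : Equiv.Perm (Fin N))
    (f : (Fin N → X) → ℝ≥0∞) :
    ∫⁻ z, f (z ∘ π) ∂(Measure.pi fun _ => μ) = ∫⁻ z, f z ∂(Measure.pi fun _ => μ) := by
  have h := measurePreserving_arrowCongr' (fun _ : Fin N => μ) (fun _ : Fin N => μ) π.symm
    (MeasurableEquiv.refl X) fun _ => MeasurePreserving.id μ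
  rw [← h.lintegral_comp_emb (MeasurableEquiv.measurableEmbedding _) f]
  rfl

theorem lintegral_pi_eval (μ : Measure X) [IsProbabilityMeasure μ] (i : Fin N)
    {f : X → ℝ≥0∞} (hf : Measurable f) :
    ∫⁻ z, f (z i) ∂(Measure.pi fun _ => μ) = ∫⁻ x, f x ∂μ :=
  (measurePreserving_eval (fun _ : Fin N => μ) i).lintegral_comp hf

/-- Coordinate `0` of a sample is independent of the remaining ones. -/
theorem lintegral_pi_succ (μ : Measure X) [IsProbabilityMeasure μ]
    {F : (Fin N → X) → X → ℝ≥0∞} (hF : Measurable (Function.uncurry F)) :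
    ∫⁻ z, F (Fin.tail z) (z 0) ∂(Measure.pi fun _ : Fin (N + 1) => μ)
      = ∫⁻ w, ∫⁻ x, F w x ∂μ ∂(Measure.pi fun _ : Fin N => μ) := by
  have h := measurePreserving_piFinSuccAbove (fun _ : Fin (N + 1) => μ) 0
  have hF' : Measurable fun p : X × (Fin N → X) => F p.2 p.1 := hF.comp measurable_swap
  exact (h.lintegral_comp hF').trans (lintegral_prod_symm' _ hF')

/-- A sample of size `N` together with an independent test point is a sample of size `N + 1`. -/
theorem lintegral_sample_test {Ω : Type*} [MeasurableSpace Ω] {P : Measure Ω}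
    [IsProbabilityMeasure P] {μ : Measure X} [IsProbabilityMeasure μ] {T : ℕ → Ω → X}
    (hT : ∀ t, Measurable (T t)) (h_law : ∀ t, P.map (T t) = μ) (h_indep : iIndepFun T P)
    {F : (Fin N → X) → X → ℝ≥0∞} (hF : Measurable (Function.uncurry F)) :
    ∫⁻ ω, ∫⁻ x, F (fun t => T t ω) x ∂μ ∂P
      = ∫⁻ z, F (Fin.tail z) (z 0) ∂(Measure.pi fun _ : Fin (N + 1) => μ) := by
  have h1 : P.map (fun ω (t : Fin N) => T t ω) = Measure.pi fun _ => μ := by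
    have := (iIndepFun_iff_map_fun_eq_pi_map (fun t : Fin N => (hT t).aemeasurable)).mp
      (h_indep.precomp Fin.val_injective)
    simpa only [h_law] using this
  have hF' : Measurable fun w : Fin N → X => ∫⁻ x, F w x ∂μ := hF.lintegral_prod_right'
  rw [lintegral_pi_succ μ hF, ← h1, lintegral_map hF' (by fun_prop)]

theorem MeasureTheory.MemLp.integrable_inner_of_two {E : Type*} [NormedAddCommGroup E]
    [InnerProductSpace ℝ E] {μ : Measure X} {f g : X → E} (hf : MemLp f 2 μ) (hg : MemLp g 2 μ) :
    Integrable (fun x => inner ℝ (f x) (g x)) μ := by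
  refine (hf.norm.integrable_mul hg.norm).mono (hf.1.inner (𝕜 := ℝ) hg.1) (ae_of_all _ fun x => ?_)
  simpa using norm_inner_le_norm (𝕜 := ℝ) (f x) (g x)

/-- Pythagoras for square integrable functions. -/
theorem lintegral_enorm_sq_sum_of_orthogonal {E : Type*} [NormedAddCommGroup E]
    [InnerProductSpace ℝ E] {μ : Measure X} {f : Fin N → X → E} (hf : ∀ i, MemLp (f i) 2 μ)
    (h : ∀ i j, i ≠ j → ∫ x, inner ℝ (f i x) (f j x) ∂μ = 0) :
    ∫⁻ x, ‖∑ i, f i x‖ₑ ^ 2 ∂μ = ∑ i, ∫⁻ x, ‖f i x‖ₑ ^ 2 ∂μ := by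
  have key : ∀ g : X → E, MemLp g 2 μ →
      ∫⁻ x, ‖g x‖ₑ ^ 2 ∂μ = ENNReal.ofReal (∫ x, inner ℝ (g x) (g x) ∂μ) := fun g hg => by
    rw [ofReal_integral_eq_lintegral_ofReal (hg.integrable_inner_of_two hg)
      (ae_of_all _ fun x => real_inner_self_nonneg)]
    refine lintegral_congr fun x => ?_
    rw [real_inner_self_eq_norm_sq, ENNReal.ofReal_pow (norm_nonneg _), ofReal_norm]
  rw [key _ (memLp_finsetSum _ fun i _ => hf i)]
  simp only [key _ (hf _)]
  rw [← ENNReal.ofReal_sum_of_nonneg fun i _ => integral_nonneg fun x => real_inner_self_nonneg]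
  congr 1
  simp only [sum_inner, inner_sum]
  rw [integral_finsetSum _ fun i _ => integrable_finsetSum _ fun j _ =>
    (hf j).integrable_inner_of_two (hf i)]
  refine Finset.sum_congr rfl fun i _ => ?_
  rw [integral_finsetSum _ fun j _ => (hf j).integrable_inner_of_two (hf i)]
  exact Finset.sum_eq_single i (fun j _ hj => h j i hj) (by simp)

end Sample

section Bounds

variable {d m N : ℕ} {σ σn : ℝ}

theorem measurable_gprDual (hσn : 0 < σn) {X : Type*} [MeasurableSpace X]
    {S : X → Fin N → Vec d} {Y : X → Fin N → Vec m} (hS : Measurable S) (hY : Measurable Y)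
    (i : Fin N) : Measurable fun x => gprDual σ σn (S x) (Y x) i := by
  unfold gprDual
  refine Finset.measurable_fun_sum _ fun j _ => ?_
  have h1 : Measurable fun x => (gprGram σ σn (S x))⁻¹ i j :=
    (Continuous.gprGram_inv hσn (S := fun s : Fin N → Vec d => s)
      (fun i => continuous_apply i) i j).measurable.comp hS
  have h2 : Measurable fun x => Y x j := (measurable_pi_apply j).comp hY
  exact h1.smul h2

theorem measurable_gprWeight (hσn : 0 < σn) {X : Type*} [MeasurableSpace X]
    {S : X → Fin N → Vec d} {s : X → Vec d} (hS : Measurable S) (hs : Measurable s) (i : Fin N) :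
    Measurable fun x => gprWeight σ σn (S x) (s x) i := by
  simp only [gprWeight, Matrix.vecMul, dotProduct]
  refine Finset.measurable_fun_sum _ fun j _ => ?_
  have h1 : Measurable fun x => (gprGram σ σn (S x))⁻¹ j i :=
    (Continuous.gprGram_inv hσn (S := fun s : Fin N → Vec d => s)
      (fun i => continuous_apply i) j i).measurable.comp hS
  have h2 : Measurable fun x => S x j := (measurable_pi_apply j).comp hS
  have h3 : Measurable fun x => rbfKernel σ (S x j) (s x) := by
    unfold rbfKernel
    fun_prop
  exact h3.mul h1

theorem measurable_gprTerm (hσn : 0 < σn) {X : Type*} [MeasurableSpace X]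
    {S : X → Fin N → Vec d} {Y : X → Fin N → Vec m} {s : X → Vec d} (hS : Measurable S)
    (hY : Measurable Y) (hs : Measurable s) :
    Measurable fun x => gprTerm σ σn (S x) (Y x) (s x) := by
  simp only [gprTerm_eq_sum]
  refine Finset.measurable_fun_sum _ fun i _ => ?_
  have h2 : Measurable fun x => Y x i := (measurable_pi_apply i).comp hY
  exact (measurable_gprWeight hσn hS hs i).smul h2

theorem enorm_sq_eq_ofReal {E : Type*} [SeminormedAddCommGroup E] (x : E) :
    ‖x‖ₑ ^ 2 = ENNReal.ofReal (‖x‖ ^ 2) := by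
  rw [ENNReal.ofReal_pow (norm_nonneg _), ofReal_norm]

/-- Learning curve for noise-free outputs `u(s)`: up to a constant, the expected error at an
independent test point is at most the training error of an arbitrary competitor `g` in the
reproducing kernel Hilbert space. The leave-one-out identity turns the test error into a training
error. -/
theorem lintegral_noiseless_error_le (hσn : 0 < σn) (ρ : Measure (Vec d)) [IsProbabilityMeasure ρ]
    {u : Vec d → Vec m} (hu : Measurable u) (g : RBFSpace d m σ) :
    ∫⁻ x, ‖u (x 0) - gprTerm σ σn (Fin.tail x) (fun t => u (Fin.tail x t)) (x 0)‖ₑ ^ 2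
        ∂(Measure.pi fun _ : Fin (N + 1) => ρ)
      ≤ ENNReal.ofReal (((1 + σn ^ 2) / σn ^ 2) ^ 2) *
        (ENNReal.ofReal (σn ^ 2 * ‖g‖ ^ 2) / (N + 1 : ℕ) + ∫⁻ x, ‖u x - g x‖ₑ ^ 2 ∂ρ) := by
  set D : Fin (N + 1) → (Fin (N + 1) → Vec d) → ℝ≥0∞ :=
    fun i x => ‖gprDual σ σn x (fun t => u (x t)) i‖ₑ ^ 2 with hD
  have hDm : ∀ i, Measurable (D i) := fun i =>
    ((measurable_gprDual hσn measurable_id (by fun_prop) i).enorm).pow_const 2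
  have h1 : ∀ x : Fin (N + 1) → Vec d,
      ‖u (x 0) - gprTerm σ σn (Fin.tail x) (fun t => u (Fin.tail x t)) (x 0)‖ₑ ^ 2
        ≤ ENNReal.ofReal ((1 + σn ^ 2) ^ 2) * D 0 x := fun x => by
    have h := sub_gprTerm_tail (σ := σ) hσn x (fun t => u (x t))
    have hc := gprVariance_le (σ := σ) hσn (Fin.tail x) (x 0)
    have hc0 := (sq_nonneg σn).trans (sq_le_gprVariance (σ := σ) hσn (Fin.tail x) (x 0))
    have h' : u (x 0) - gprTerm σ σn (Fin.tail x) (fun t => u (Fin.tail x t)) (x 0) = _ := h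
    rw [h', hD]
    simp only [enorm_sq_eq_ofReal]
    rw [← ENNReal.ofReal_mul (by positivity), norm_smul, Real.norm_of_nonneg hc0, mul_pow]
    gcongr
  have h2 : ∀ i, ∫⁻ x, D i x ∂(Measure.pi fun _ => ρ) = ∫⁻ x, D 0 x ∂(Measure.pi fun _ => ρ) :=
    fun i => by
    rw [← lintegral_pi_comp_perm ρ (Equiv.swap 0 i) (D i)]
    refine lintegral_congr fun x => ?_
    have := gprDual_comp_perm (σ := σ) (σn := σn) x (fun t => u (x t)) (Equiv.swap 0 i) i
    rw [Equiv.swap_apply_right] at this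
    rw [hD]
    simp only
    rw [← this]
    rfl
  have h3 : ∀ x, ∑ i, D i x ≤ ENNReal.ofReal ((σn ^ 4)⁻¹) *
      (ENNReal.ofReal (σn ^ 2 * ‖g‖ ^ 2) + ∑ i, ‖u (x i) - g (x i)‖ₑ ^ 2) := fun x => by
    have h := sum_sq_dual_le hσn x (fun t => u (x t)) g
    simp only [hD, enorm_sq_eq_ofReal]
    rw [← ENNReal.ofReal_sum_of_nonneg fun i _ => by positivity,
      ← ENNReal.ofReal_sum_of_nonneg fun i _ => by positivity,
      ← ENNReal.ofReal_add (by positivity) (by positivity), ← ENNReal.ofReal_mul (by positivity)]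
    refine ENNReal.ofReal_le_ofReal ?_
    rw [← div_eq_inv_mul, le_div_iff₀ (by positivity), mul_comm]
    exact h
  have hgm : Measurable fun x => ‖u x - g x‖ₑ ^ 2 :=
    ((hu.sub (continuous_rbfSpace g).measurable).enorm).pow_const 2
  have h4 : ((N + 1 : ℕ) : ℝ≥0∞) * ∫⁻ x, D 0 x ∂(Measure.pi fun _ => ρ)
      ≤ ENNReal.ofReal ((σn ^ 4)⁻¹) * (ENNReal.ofReal (σn ^ 2 * ‖g‖ ^ 2)
        + (N + 1 : ℕ) * ∫⁻ x, ‖u x - g x‖ₑ ^ 2 ∂ρ) := by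
    calc ((N + 1 : ℕ) : ℝ≥0∞) * ∫⁻ x, D 0 x ∂(Measure.pi fun _ => ρ)
        = ∫⁻ x, ∑ i, D i x ∂(Measure.pi fun _ => ρ) := by
          rw [lintegral_finsetSum _ fun i _ => hDm i]
          simp [h2]
      _ ≤ _ := lintegral_mono h3
      _ = _ := by
          rw [lintegral_const_mul' _ _ ENNReal.ofReal_ne_top, lintegral_add_left measurable_const,
            lintegral_finsetSum (f := fun i (x : Fin (N + 1) → Vec d) => ‖u (x i) - g (x i)‖ₑ ^ 2)
              _ fun i _ => hgm.comp (measurable_pi_apply i)]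
          simp only [fun i => lintegral_pi_eval ρ i hgm]
          simp
  have h5 : ∫⁻ x, D 0 x ∂(Measure.pi fun _ => ρ) ≤ ENNReal.ofReal ((σn ^ 4)⁻¹) *
      (ENNReal.ofReal (σn ^ 2 * ‖g‖ ^ 2) / (N + 1 : ℕ) + ∫⁻ x, ‖u x - g x‖ₑ ^ 2 ∂ρ) := by
    have hN : ((N + 1 : ℕ) : ℝ≥0∞) ≠ 0 := by simp
    have hN' : ((N + 1 : ℕ) : ℝ≥0∞) ≠ ⊤ := ENNReal.natCast_ne_top _
    rw [← ENNReal.mul_le_mul_iff_right hN hN']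
    refine h4.trans (le_of_eq ?_)
    conv_rhs => rw [mul_left_comm, mul_add, ENNReal.mul_div_cancel hN hN']
  calc _ ≤ ∫⁻ x, ENNReal.ofReal ((1 + σn ^ 2) ^ 2) * D 0 x ∂(Measure.pi fun _ => ρ) :=
        lintegral_mono h1
    _ ≤ _ := by
        rw [lintegral_const_mul' _ _ ENNReal.ofReal_ne_top]
        grw [h5]
        rw [← mul_assoc, ← ENNReal.ofReal_mul (by positivity)]
        refine le_of_eq ?_
        congr 2
        field_simp

end Bounds

/-! ### The contribution of centred noise -/

section Noise

variable {d m N : ℕ} {σ σn : ℝ}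

/-- Noise with conditional mean zero given the inputs is uncorrelated across the sample, even after
weighting with a bounded function of all inputs. -/
theorem integral_weight_inner_eq_zero {μ : Measure (Vec d × Vec m)} [IsProbabilityMeasure μ]
    {ξ : Vec d × Vec m → Vec m} (hξ : MemLp ξ 2 μ)
    (h0 : ∀ h : Vec d → ℝ, Measurable h → (∃ M, ∀ x, |h x| ≤ M) → ∫ z, h z.1 • ξ z ∂μ = 0)
    {β : (Fin (N + 1) → Vec d) → ℝ} (hβ : Measurable β) {M : ℝ} (hM : ∀ x, |β x| ≤ M)
    {i j : Fin (N + 1)} (hij : i ≠ j) :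
    ∫ z, β (fun t => (z t).1) * inner ℝ (ξ (z i)) (ξ (z j)) ∂(Measure.pi fun _ => μ) = 0 := by
  obtain ⟨l, rfl⟩ := Fin.exists_succAbove_eq hij.symm
  have hmp := measurePreserving_piFinSuccAbove (fun _ : Fin (N + 1) => μ) i
  have hLp : ∀ k, MemLp (fun z : Fin (N + 1) → Vec d × Vec m => ξ (z k)) 2
      (Measure.pi fun _ => μ) := fun k =>
    hξ.comp_measurePreserving (measurePreserving_eval (fun _ : Fin (N + 1) => μ) k)
  have hβm : Measurable fun z : Fin (N + 1) → Vec d × Vec m => β (fun t => (z t).1) :=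
    hβ.comp (by fun_prop)
  have hint : Integrable (fun z : Fin (N + 1) → Vec d × Vec m =>
      β (fun t => (z t).1) * inner ℝ (ξ (z i)) (ξ (z (i.succAbove l))))
      (Measure.pi fun _ => μ) :=
    ((hLp i).integrable_inner_of_two (hLp _)).bdd_mul hβm.aestronglyMeasurable
      (ae_of_all _ fun z => hM _)
  set F : (Vec d × Vec m) × (Fin N → Vec d × Vec m) → ℝ := fun p =>
    β (fun t => (i.insertNth (α := fun _ => Vec d × Vec m) p.1 p.2 t).1)
      * inner ℝ (ξ p.1) (ξ (p.2 l)) with hF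
  have hcomp : (fun z : Fin (N + 1) → Vec d × Vec m =>
      β (fun t => (z t).1) * inner ℝ (ξ (z i)) (ξ (z (i.succAbove l))))
      = F ∘ MeasurableEquiv.piFinSuccAbove (fun _ => Vec d × Vec m) i := by
    ext z
    simp [hF, Fin.insertNthEquiv, Fin.removeNth]
  rw [hcomp] at hint ⊢
  rw [hmp.integrable_comp_emb (MeasurableEquiv.measurableEmbedding _)] at hint
  change ∫ z, F (MeasurableEquiv.piFinSuccAbove (fun _ => Vec d × Vec m) i z) ∂_ = 0
  rw [hmp.integral_comp (MeasurableEquiv.measurableEmbedding _), integral_prod_symm _ hint]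
  refine integral_eq_zero_of_ae (ae_of_all _ fun w => ?_)
  set h : Vec d → ℝ := fun x =>
    β (i.insertNth (α := fun _ => Vec d) x (fun t => (w t).1)) with hh
  have hhm : Measurable h := hβ.comp (by
    refine measurable_pi_lambda _ fun t => ?_
    refine Fin.succAboveCases i ?_ (fun k => ?_) t
    · simpa using measurable_id'
    · simp)
  have h1 : ∀ z : Vec d × Vec m, F (z, w) = inner ℝ (ξ (w l)) (h z.1 • ξ z) := fun z => by
    have h2 : (fun t => (i.insertNth (α := fun _ => Vec d × Vec m) z w t).1)
        = i.insertNth (α := fun _ => Vec d) z.1 (fun t => (w t).1) := by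
      ext1 t
      refine Fin.succAboveCases i ?_ (fun k => ?_) t <;> simp
    simp only [hF, h2, hh, inner_smul_right, real_inner_comm]
  simp only [h1, Pi.zero_apply]
  rw [integral_inner, h0 h hhm ⟨M, fun x => hM _⟩, inner_zero_right]
  exact (hξ.integrable one_le_two).bdd_smul M (hhm.comp measurable_fst).aestronglyMeasurable
    (ae_of_all _ fun z => hM _)

/-- The mean squared contribution of centred noise to the prediction at an independent test point.
Noise terms are uncorrelated, and exchanging the test point with a training point moves all of
the noise to the test point. -/
theorem lintegral_noise_le (hσn : 0 < σn) {μ : Measure (Vec d × Vec m)} [IsProbabilityMeasure μ]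
    {ξ : Vec d × Vec m → Vec m} (hξm : Measurable ξ) (hξ : MemLp ξ 2 μ)
    (h0 : ∀ h : Vec d → ℝ, Measurable h → (∃ M, ∀ x, |h x| ≤ M) → ∫ z, h z.1 • ξ z ∂μ = 0) :
    ∫⁻ z, ‖gprTerm σ σn (fun t => (Fin.tail z t).1) (fun t => ξ (Fin.tail z t)) (z 0).1‖ₑ ^ 2
        ∂(Measure.pi fun _ : Fin (N + 1) => μ)
      ≤ ENNReal.ofReal (((1 + σn ^ 2) / σn ^ 2) ^ 2) *
        ∫⁻ z, ‖ξ (z 0)‖ₑ ^ 2 * ∑ i, ‖gprWeight σ σn (fun t => (Fin.tail z t).1) (z 0).1 i‖ₑ ^ 2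
          ∂(Measure.pi fun _ : Fin (N + 1) => μ) := by
  set inp : (Fin (N + 1) → Vec d × Vec m) → Fin (N + 1) → Vec d := fun z t => (z t).1 with hinp
  have hinpm : Measurable inp := by fun_prop
  set a : Fin N → (Fin (N + 1) → Vec d) → ℝ :=
    fun i x => gprWeight σ σn (Fin.tail x) (x 0) i with ha
  have ham : ∀ i, Measurable (a i) := fun i => measurable_gprWeight hσn
    (S := fun x : Fin (N + 1) → Vec d => Fin.tail x) (s := fun x => x 0)
    (measurable_pi_lambda _ fun t => measurable_pi_apply t.succ) (measurable_pi_apply 0) i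
  have hab : ∀ i x, |a i x| ≤ σn⁻¹ := fun i x => by
    have h1 := gprWeight_sq_le (σ := σ) hσn (Fin.tail x) (x 0)
    have h2 : a i x ^ 2
        ≤ gprWeight σ σn (Fin.tail x) (x 0) ⬝ᵥ gprWeight σ σn (Fin.tail x) (x 0) := by
      rw [sq, dotProduct]
      exact Finset.single_le_sum (f := fun i => gprWeight σ σn (Fin.tail x) (x 0) i
        * gprWeight σ σn (Fin.tail x) (x 0) i) (fun i _ => mul_self_nonneg _) (Finset.mem_univ i)
    refine abs_le_of_sq_le_sq (h2.trans (h1.trans (le_of_eq (inv_pow _ _).symm))) (by positivity)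
  set b : Fin N → (Fin (N + 1) → Vec d) → ℝ :=
    fun i x => (gprGram σ σn x)⁻¹ i.succ 0 with hb
  have hba : ∀ i x, gprVariance σ σn (Fin.tail x) (x 0) * b i x = -a i x := fun i x => by
    have h := gprVariance_mul_gprGram_inv (σ := σ) hσn x i.succ
    rwa [Fin.cons_succ, Pi.neg_apply] at h
  have hLp : ∀ k, MemLp (fun z : Fin (N + 1) → Vec d × Vec m => ξ (z k)) 2
      (Measure.pi fun _ => μ) := fun k =>
    hξ.comp_measurePreserving (measurePreserving_eval (fun _ : Fin (N + 1) => μ) k)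
  have hfLp : ∀ i, MemLp (fun z : Fin (N + 1) → Vec d × Vec m => a i (inp z) • ξ (z i.succ)) 2
      (Measure.pi fun _ => μ) := fun i => by
    refine MemLp.of_le_mul (c := σn⁻¹) (hLp i.succ)
      (((ham i).comp hinpm).aestronglyMeasurable.smul (hLp i.succ).1) (ae_of_all _ fun z => ?_)
    rw [norm_smul]
    exact mul_le_mul_of_nonneg_right (hab i _) (norm_nonneg _)
  -- exchange the test point with the `i`-th training point
  have hswap : ∀ i : Fin N,
      ∫⁻ z, ‖b i (inp z)‖ₑ ^ 2 * ‖ξ (z i.succ)‖ₑ ^ 2 ∂(Measure.pi fun _ => μ)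
        = ∫⁻ z, ‖b i (inp z)‖ₑ ^ 2 * ‖ξ (z 0)‖ₑ ^ 2 ∂(Measure.pi fun _ => μ) := fun i => by
    rw [← lintegral_pi_comp_perm μ (Equiv.swap 0 i.succ)]
    refine lintegral_congr fun z => ?_
    have h1 : b i (inp (z ∘ Equiv.swap 0 i.succ)) = b i (inp z) := by
      have h := gprGram_inv_comp_perm (σ := σ) (σn := σn) (inp z) (Equiv.swap 0 i.succ) i.succ 0
      rw [Equiv.swap_apply_right, Equiv.swap_apply_left,
        gprGram_inv_comm (inp z) 0 i.succ] at h
      exact h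
    rw [h1, Function.comp_apply, Equiv.swap_apply_right]
  have hup : ∀ i x, ‖a i x‖ₑ ^ 2 ≤ ENNReal.ofReal ((1 + σn ^ 2) ^ 2) * ‖b i x‖ₑ ^ 2 :=
    fun i x => by
    rw [enorm_sq_eq_ofReal, enorm_sq_eq_ofReal, ← ENNReal.ofReal_mul (by positivity),
      ← norm_neg (a i x), ← hba, norm_mul, mul_pow]
    have h1 := gprVariance_le (σ := σ) hσn (Fin.tail x) (x 0)
    have h2 := (sq_nonneg σn).trans (sq_le_gprVariance (σ := σ) hσn (Fin.tail x) (x 0))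
    rw [Real.norm_of_nonneg h2]
    gcongr
  have hdown : ∀ i x, ‖b i x‖ₑ ^ 2 ≤ ENNReal.ofReal ((σn ^ 4)⁻¹) * ‖a i x‖ₑ ^ 2 :=
    fun i x => by
    rw [enorm_sq_eq_ofReal, enorm_sq_eq_ofReal, ← ENNReal.ofReal_mul (by positivity),
      ← norm_neg (a i x), ← hba, norm_mul, mul_pow]
    have h1 := sq_le_gprVariance (σ := σ) hσn (Fin.tail x) (x 0)
    have h2 := (sq_nonneg σn).trans h1
    rw [Real.norm_of_nonneg h2, ← mul_assoc]
    refine ENNReal.ofReal_le_ofReal (le_mul_of_one_le_left (by positivity) ?_)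
    rw [← div_eq_inv_mul, one_le_div (by positivity)]
    calc σn ^ 4 = (σn ^ 2) ^ 2 := by ring
      _ ≤ _ := by gcongr
  calc ∫⁻ z, ‖gprTerm σ σn (fun t => (Fin.tail z t).1) (fun t => ξ (Fin.tail z t)) (z 0).1‖ₑ ^ 2
        ∂(Measure.pi fun _ : Fin (N + 1) => μ)
      = ∫⁻ z, ‖∑ i, a i (inp z) • ξ (z i.succ)‖ₑ ^ 2 ∂(Measure.pi fun _ => μ) := rfl
    _ = ∑ i, ∫⁻ z, ‖a i (inp z) • ξ (z i.succ)‖ₑ ^ 2 ∂(Measure.pi fun _ => μ) := by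
        refine lintegral_enorm_sq_sum_of_orthogonal hfLp fun i j hij => ?_
        have h := integral_weight_inner_eq_zero hξ h0 (β := fun x => a i x * a j x)
          ((ham i).mul (ham j)) (M := σn⁻¹ * σn⁻¹) (fun x => by
            rw [abs_mul]
            exact mul_le_mul (hab i x) (hab j x) (abs_nonneg _) (by positivity))
          (fun h => hij (Fin.succ_injective _ h) : i.succ ≠ j.succ)
        rw [← h]
        refine integral_congr_ae (ae_of_all _ fun z => ?_)
        simp only [inner_smul_left, inner_smul_right, conj_trivial, hinp]
        ring
    _ ≤ ∑ i, ENNReal.ofReal ((1 + σn ^ 2) ^ 2) *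
          ∫⁻ z, ‖b i (inp z)‖ₑ ^ 2 * ‖ξ (z i.succ)‖ₑ ^ 2 ∂(Measure.pi fun _ => μ) := by
        refine Finset.sum_le_sum fun i _ => ?_
        rw [← lintegral_const_mul' _ _ ENNReal.ofReal_ne_top]
        refine lintegral_mono fun z => ?_
        rw [enorm_smul, mul_pow, ← mul_assoc]
        exact mul_le_mul_left (hup i _) _
    _ = ∑ i, ENNReal.ofReal ((1 + σn ^ 2) ^ 2) *
          ∫⁻ z, ‖b i (inp z)‖ₑ ^ 2 * ‖ξ (z 0)‖ₑ ^ 2 ∂(Measure.pi fun _ => μ) := by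
        simp only [hswap]
    _ ≤ ∑ i, ENNReal.ofReal (((1 + σn ^ 2) / σn ^ 2) ^ 2) *
          ∫⁻ z, ‖ξ (z 0)‖ₑ ^ 2 * ‖a i (inp z)‖ₑ ^ 2 ∂(Measure.pi fun _ => μ) := by
        refine Finset.sum_le_sum fun i _ => ?_
        rw [show ((1 + σn ^ 2) / σn ^ 2) ^ 2 = (1 + σn ^ 2) ^ 2 * (σn ^ 4)⁻¹ by field_simp,
          ENNReal.ofReal_mul (by positivity), mul_assoc]
        gcongr
        rw [← lintegral_const_mul' _ _ ENNReal.ofReal_ne_top]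
        refine lintegral_mono fun z => ?_
        rw [mul_comm (‖ξ _‖ₑ ^ 2), ← mul_assoc]
        exact mul_le_mul_left (hdown i _) _
    _ = _ := by
        rw [← Finset.mul_sum, ← lintegral_finsetSum]
        · simp only [← Finset.mul_sum]
          rfl
        · intro i _
          exact ((hξm.comp (measurable_pi_apply _)).enorm.pow_const 2).mul
            (((ham i).comp hinpm).enorm.pow_const 2)

end Noise

/-! ### Vanishing of the prediction weights -/

section Weights

variable {d m : ℕ} {σ σn : ℝ}

/-- If the training inputs return to every neighbourhood of `s`, then averaging the outputs of `n`
of the nearby inputs is a competitor with small regularized distance to `k(·, s)`. Hence the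
posterior variance at `s`, and with it the weights, tend to zero. -/
theorem tendsto_gprWeight_sq (hσn : 0 < σn) (S : ℕ → Vec d) (s : Vec d)
    (hrec : ∀ U ∈ 𝓝 s, ∃ᶠ t in atTop, S t ∈ U) :
    Tendsto (fun N : ℕ => gprWeight σ σn (fun t : Fin N => S t) s ⬝ᵥ
      gprWeight σ σn (fun t : Fin N => S t) s) atTop (𝓝 0) := by
  rw [tendsto_order]
  refine ⟨fun ε hε => Eventually.of_forall fun N => hε.trans_le (dotProduct_self_nonneg_of_real _),
    fun ε hε => ?_⟩
  obtain ⟨δ, hδ, hδε⟩ : ∃ δ > 0, 2 * δ < σn ^ 2 * ε / 2 :=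
    ⟨σn ^ 2 * ε / 8, by positivity, by nlinarith [mul_pos (pow_pos hσn 2) hε]⟩
  obtain ⟨n, hn0, hn⟩ : ∃ n : ℕ, 0 < n ∧ (n : ℝ)⁻¹ < ε / 2 := by
    obtain ⟨n, hn⟩ := exists_nat_gt (2 / ε)
    have hn0 : (0 : ℝ) < n := (by positivity : (0 : ℝ) < 2 / ε).trans hn
    exact ⟨n, by exact_mod_cast hn0, by
      rw [inv_lt_comm₀ hn0 (by positivity)]
      simpa using hn⟩
  have hU : {x | 1 - δ < rbfKernel σ x s} ∈ 𝓝 s := by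
    have hc : Continuous fun x => rbfKernel σ x s := by fun_prop
    refine hc.continuousAt.eventually_const_lt ?_
    simp only [rbfKernel_self]
    linarith
  have hinf := Nat.frequently_atTop_iff_infinite.mp (hrec _ hU)
  -- `t` consists of `n` times at which the input is close to `s`; the competitor `b` is uniform
  -- on `t`
  obtain ⟨t, ht, htn⟩ := hinf.exists_subset_card_eq n
  obtain ⟨N₀, hN₀⟩ := t.exists_nat_subset_range
  filter_upwards [eventually_ge_atTop N₀] with N hN
  set b : Fin N → ℝ := fun i => if (i : ℕ) ∈ t then (n : ℝ)⁻¹ else 0 with hb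
  have hsum : ∀ f : ℕ → ℝ, ∑ i : Fin N, b i * f i = (n : ℝ)⁻¹ * ∑ i ∈ t, f i := fun f => by
    rw [Fin.sum_univ_eq_sum_range (fun i => (if i ∈ t then (n : ℝ)⁻¹ else 0) * f i) N]
    simp only [ite_mul, zero_mul]
    rw [← Finset.sum_filter, Finset.mul_sum]
    refine Finset.sum_congr ?_ fun _ _ => rfl
    ext i
    simp only [Finset.mem_filter, Finset.mem_range, and_iff_right_iff_imp]
    exact fun hi => (Finset.mem_range.mp (hN₀ hi)).trans_le hN
  have hnR : (0 : ℝ) < n := by exact_mod_cast hn0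
  have h1 : 1 - δ ≤ ∑ i : Fin N, b i * rbfKernel σ (S i) s := by
    rw [hsum fun i => rbfKernel σ (S i) s, ← div_eq_inv_mul, le_div_iff₀ hnR, ← htn,
      mul_comm, ← nsmul_eq_mul]
    exact Finset.card_nsmul_le_sum _ _ _ fun i hi => (ht hi).le
  have h2 : ∑ i : Fin N, b i * ∑ j : Fin N, rbfKernel σ (S i) (S j) * b j ≤ 1 := by
    have h3 : ∀ i : ℕ, ∑ j : Fin N, rbfKernel σ (S i) (S j) * b j ≤ 1 := fun i => by
      simp only [mul_comm _ (b _)]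
      rw [hsum fun j => rbfKernel σ (S i) (S j), ← div_eq_inv_mul, div_le_one hnR, ← htn]
      simpa using Finset.sum_le_card_nsmul t _ 1 fun j _ => rbfKernel_le_one (σ := σ) (S i) (S j)
    rw [hsum fun i => ∑ j : Fin N, rbfKernel σ (S i) (S j) * b j, ← div_eq_inv_mul,
      div_le_one hnR, ← htn]
    simpa using Finset.sum_le_card_nsmul t _ 1 fun i _ => h3 i
  have h4 : b ⬝ᵥ b = (n : ℝ)⁻¹ := by
    have h5 := hsum fun i => if i ∈ t then (n : ℝ)⁻¹ else 0
    rw [Finset.sum_congr rfl fun i hi => if_pos hi] at h5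
    rw [dotProduct, h5, Finset.sum_const, htn, nsmul_eq_mul]
    field_simp
  have h6 := gprWeight_sq_le_variance (σ := σ) hσn (fun t : Fin N => S t) s
  have h7 := variance_le (σ := σ) hσn (fun t : Fin N => S t) s b
  rw [h4] at h7
  have h8 : σn ^ 2 * (n : ℝ)⁻¹ < σn ^ 2 * (ε / 2) := mul_lt_mul_of_pos_left hn (by positivity)
  have h9 : σn ^ 2 * (gprWeight σ σn (fun t : Fin N => S t) s ⬝ᵥ
      gprWeight σ σn (fun t : Fin N => S t) s) < σn ^ 2 * ε := by linarith
  exact lt_of_mul_lt_mul_left h9 (by positivity)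

/-- By the second Borel–Cantelli lemma, an i.i.d. sequence almost surely returns infinitely often
to every neighbourhood of almost every point. -/
theorem ae_frequently_mem_nhds {X : Type*} [TopologicalSpace X] [SecondCountableTopology X]
    [MeasurableSpace X] [OpensMeasurableSpace X]
    {Ω : Type*} [MeasurableSpace Ω] {P : Measure Ω} [IsProbabilityMeasure P] {ρ : Measure X}
    {T : ℕ → Ω → X} (hT : ∀ t, Measurable (T t)) (h_law : ∀ t, P.map (T t) = ρ)
    (h_indep : iIndepFun T P) :
    ∀ᵐ ω ∂P, ∀ᵐ x ∂ρ, ∀ U ∈ 𝓝 x, ∃ᶠ t in atTop, T t ω ∈ U := by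
  set B := TopologicalSpace.countableBasis X
  have hB := TopologicalSpace.isBasis_countableBasis X
  have hBc : B.Countable := TopologicalSpace.countable_countableBasis X
  -- a countable basis reduces both exceptional sets to countable unions of null sets
  have h1 : ∀ᵐ ω ∂P, ∀ U ∈ B, ρ U ≠ 0 → ∃ᶠ t in atTop, T t ω ∈ U := by
    rw [ae_ball_iff hBc]
    intro U hU
    by_cases h0 : ρ U = 0
    · simp [h0]
    have hUm : MeasurableSet U := (hB.isOpen hU).measurableSet
    have hm : ∀ t, P (T t ⁻¹' U) = ρ U := fun t => by
      rw [← h_law t, Measure.map_apply (hT t) hUm]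
    have h2 := measure_limsup_eq_one (s := fun t => T t ⁻¹' U) (μ := P) (fun t => hT t hUm)
      ?_ ?_
    · have h3 : ∀ᵐ ω ∂P, ω ∈ limsup (fun t => T t ⁻¹' U) atTop := by
        rw [← prob_compl_eq_zero_iff (MeasurableSet.measurableSet_limsup fun t => hT t hUm)] at h2
        exact h2
      filter_upwards [h3] with ω hω _
      exact mem_limsup_iff_frequently_mem.mp hω
    · exact (iIndepSet_iff_meas_biInter fun t => hT t hUm).mpr fun t =>
        h_indep.measure_inter_preimage_eq_mul t fun _ _ => hUm
    · simp only [hm]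
      exact ENNReal.tsum_const_eq_top_of_ne_zero h0
  have h2 : ∀ᵐ x ∂ρ, ∀ U ∈ B, x ∈ U → ρ U ≠ 0 := by
    rw [ae_ball_iff hBc]
    intro U hU
    by_cases h0 : ρ U = 0
    · have : ∀ᵐ x ∂ρ, x ∉ U := measure_eq_zero_iff_ae_notMem.mp h0
      filter_upwards [this] with x hx hxU using absurd hxU hx
    · exact ae_of_all _ fun _ _ => h0
  filter_upwards [h1] with ω hω
  filter_upwards [h2] with x hx U hU
  obtain ⟨V, hV, hxV, hVU⟩ := hB.mem_nhds_iff.mp hU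
  exact (hω V hV (hx V hV hxV)).mono fun t ht => hVU ht

end Weights

/-! ### Density of the reproducing kernel Hilbert space in `L²(ρ)` -/

section Density

variable {d m : ℕ} {σ : ℝ}

theorem integral_char_mul_rbfKernel (t y : Vec d) :
    ∫ x : Vec d, Complex.exp ((inner ℝ t x : ℝ) * Complex.I) * (rbfKernel σ x y : ℂ)
      = Complex.exp ((inner ℝ t y : ℝ) * Complex.I) *
        ∫ x : Vec d, Complex.exp (-((1 / (2 * σ ^ 2) : ℝ) : ℂ) * (‖x‖ : ℂ) ^ 2
          + Complex.I * (inner ℝ t x : ℝ)) := by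
  rw [← integral_add_right_eq_self _ y, ← integral_const_mul]
  refine integral_congr_ae (ae_of_all _ fun x => ?_)
  simp only [rbfKernel, add_sub_cancel_right, inner_add_right, Complex.ofReal_exp,
    ← Complex.exp_add]
  congr 1
  push_cast
  ring

theorem integrable_rbfKernel (hσ : 0 < σ) (y : Vec d) :
    Integrable (fun x : Vec d => rbfKernel σ x y) := by
  have h := GaussianFourier.integrable_cexp_neg_mul_sq_norm_add (V := Vec d)
    (b := ((1 / (2 * σ ^ 2) : ℝ) : ℂ)) (by rw [Complex.ofReal_re]; positivity) 0 0
  have h2 := (h.norm).comp_sub_right y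
  refine h2.congr (ae_of_all _ fun x => ?_)
  simp only [rbfKernel, zero_mul, add_zero, Complex.norm_exp]
  congr 1
  rw [← Complex.ofReal_pow, ← Complex.ofReal_neg, ← Complex.ofReal_mul, Complex.ofReal_re]
  ring

theorem integral_rbfKernel_eq (y : Vec d) :
    ∫ x : Vec d, rbfKernel σ x y = ∫ x : Vec d, rbfKernel σ x 0 := by
  rw [← integral_add_right_eq_self _ y]
  simp [rbfKernel]

/-- A function whose Gaussian convolution against `ρ` vanishes has vanishing Fourier transform
against `ρ`, because the Fourier transform of a Gaussian has no zeros. -/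
theorem integral_char_mul_eq_zero (hσ : 0 < σ) {ρ : Measure (Vec d)} [IsFiniteMeasure ρ]
    {g : Vec d → ℝ} (hg : Integrable g ρ) (h : ∀ x, ∫ y, rbfKernel σ x y * g y ∂ρ = 0)
    (t : Vec d) : ∫ y, Complex.exp ((inner ℝ t y : ℝ) * Complex.I) * (g y : ℂ) ∂ρ = 0 := by
  set F : Vec d → Vec d → ℂ := fun x y =>
    Complex.exp ((inner ℝ t x : ℝ) * Complex.I) * (rbfKernel σ x y : ℂ) * (g y : ℂ) with hF
  have hnorm : ∀ x y, ‖F x y‖ = rbfKernel σ x y * ‖g y‖ := fun x y => by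
    simp only [hF, norm_mul, Complex.norm_exp_ofReal_mul_I, one_mul, Complex.norm_real,
      Real.norm_of_nonneg (rbfKernel_nonneg x y)]
  have hcont : Continuous fun p : Vec d × Vec d =>
      Complex.exp ((inner ℝ t p.1 : ℝ) * Complex.I) * (rbfKernel σ p.1 p.2 : ℂ) := by
    unfold rbfKernel
    fun_prop
  have hFm : AEStronglyMeasurable (Function.uncurry F) (volume.prod ρ) :=
    hcont.aestronglyMeasurable.mul
      (Complex.continuous_ofReal.comp_aestronglyMeasurable hg.1).comp_snd
  have hint : Integrable (Function.uncurry F) (volume.prod ρ) := by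
    rw [integrable_prod_iff' hFm]
    refine ⟨ae_of_all _ fun y => ?_, ?_⟩
    · have hFy : AEStronglyMeasurable (fun x => F x y) volume :=
        ((hcont.comp (continuous_id.prodMk continuous_const)).mul
          continuous_const).aestronglyMeasurable
      exact ((integrable_rbfKernel hσ y).mul_const ‖g y‖).mono' hFy
        (ae_of_all _ fun x => (hnorm x y).le)
    · simp only [Function.uncurry_apply_pair, hnorm, integral_mul_const, integral_rbfKernel_eq]
      exact hg.norm.const_mul _
  have h1 : ∫ x, ∫ y, F x y ∂ρ = 0 := by
    have h2 : ∀ x, ∫ y, F x y ∂ρ = 0 := fun x => by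
      have h3 : ∀ y, F x y = Complex.exp ((inner ℝ t x : ℝ) * Complex.I)
          * ((rbfKernel σ x y * g y : ℝ) : ℂ) := fun y => by
        simp only [hF]; push_cast; ring
      simp only [h3]
      rw [integral_const_mul, integral_complex_ofReal, h x, Complex.ofReal_zero, mul_zero]
    simp only [h2, integral_zero]
  rw [integral_integral_swap hint] at h1
  simp only [hF, integral_mul_const, integral_char_mul_rbfKernel] at h1
  have hb : 0 < ((1 / (2 * σ ^ 2) : ℝ) : ℂ).re := by rw [Complex.ofReal_re]; positivity
  have hc := GaussianFourier.integral_cexp_neg_mul_sq_norm_add (V := Vec d) hb Complex.I t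
  set c := ∫ x : Vec d, Complex.exp (-((1 / (2 * σ ^ 2) : ℝ) : ℂ) * (‖x‖ : ℂ) ^ 2
    + Complex.I * (inner ℝ t x : ℝ)) with hcdef
  -- the Gaussian integral `c` is a nonzero multiple of a value of the exponential function
  have hc0 : c ≠ 0 := by
    rw [hc]
    have hb0 : ((1 / (2 * σ ^ 2) : ℝ) : ℂ) ≠ 0 := fun h0 => by
      rw [h0, Complex.zero_re] at hb
      exact hb.false
    refine mul_ne_zero ?_ (Complex.exp_ne_zero _)
    rw [Complex.cpow_ne_zero_iff]
    exact Or.inl (div_ne_zero (by exact_mod_cast Real.pi_ne_zero) hb0)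
  have h4 : (∫ y, Complex.exp ((inner ℝ t y : ℝ) * Complex.I) * (g y : ℂ) ∂ρ) * c = 0 := by
    rw [← h1, ← integral_mul_const]
    refine integral_congr_ae (ae_of_all _ fun y => ?_)
    simp only
    ring
  exact (mul_eq_zero.mp h4).resolve_right hc0

/-- Uniqueness of the Fourier transform of the signed measure `g ρ`. -/
theorem ae_eq_zero_of_integral_char_mul_eq_zero {ρ : Measure (Vec d)} [IsFiniteMeasure ρ]
    {g : Vec d → ℝ} (hg : Integrable g ρ)
    (h : ∀ t : Vec d, ∫ y, Complex.exp ((inner ℝ t y : ℝ) * Complex.I) * (g y : ℂ) ∂ρ = 0) :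
    g =ᵐ[ρ] 0 := by
  -- compare the finite measures with densities the positive and the negative part of `g`
  have hfin : ∀ f : Vec d → ℝ, Integrable f ρ → ∫⁻ y, (f y).toNNReal ∂ρ ≠ ⊤ := fun f hf => by
    refine ne_of_lt (lt_of_le_of_lt (lintegral_mono fun y => ?_) hf.2)
    exact Real.ofReal_le_enorm _
  have hm : ∀ f : Vec d → ℝ, Integrable f ρ → AEMeasurable (fun y => (f y).toNNReal) ρ :=
    fun f hf => hf.aemeasurable.real_toNNReal
  have hchar : ∀ f : Vec d → ℝ, Integrable f ρ → ∀ t,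
      charFun (ρ.withDensity fun y => (f y).toNNReal) t
        = ∫ y, (((f y).toNNReal : ℝ) : ℂ) * Complex.exp ((inner ℝ t y : ℝ) * Complex.I) ∂ρ :=
    fun f hf t => by
    rw [charFun_apply, integral_withDensity_eq_integral_smul₀ (hm f hf)]
    refine integral_congr_ae (ae_of_all _ fun y => ?_)
    simp only [NNReal.smul_def, Complex.real_smul, real_inner_comm]
  have hint : ∀ f : Vec d → ℝ, Integrable f ρ → ∀ t : Vec d, Integrable (fun y =>
      (((f y).toNNReal : ℝ) : ℂ) * Complex.exp ((inner ℝ t y : ℝ) * Complex.I)) ρ :=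
    fun f hf t => by
    have hc : Continuous fun y : Vec d => Complex.exp ((inner ℝ t y : ℝ) * Complex.I) := by
      fun_prop
    refine (Integrable.ofReal (hf.real_toNNReal)).mul_bdd (c := 1) hc.aestronglyMeasurable
      (ae_of_all _ fun y => (Complex.norm_exp_ofReal_mul_I _).le)
  have : IsFiniteMeasure (ρ.withDensity fun y => ((g y).toNNReal : ℝ≥0∞)) :=
    isFiniteMeasure_withDensity (hfin g hg)
  have : IsFiniteMeasure (ρ.withDensity fun y => (((-g) y).toNNReal : ℝ≥0∞)) :=
    isFiniteMeasure_withDensity (hfin (-g) hg.neg)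
  have heq : ρ.withDensity (fun y => ((g y).toNNReal : ℝ≥0∞))
      = ρ.withDensity fun y => (((-g) y).toNNReal : ℝ≥0∞) := by
    refine Measure.ext_of_charFun (funext fun t => ?_)
    rw [hchar g hg, hchar (-g) hg.neg, ← sub_eq_zero, ← integral_sub (hint g hg t)
      (hint (-g) hg.neg t), ← h t]
    refine integral_congr_ae (ae_of_all _ fun y => ?_)
    have h1 : g y = ((g y).toNNReal : ℝ) - ((-g y).toNNReal : ℝ) := by
      rw [Real.coe_toNNReal', Real.coe_toNNReal']
      rcases le_total 0 (g y) with h0 | h0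
      · rw [max_eq_left h0, max_eq_right (by linarith), sub_zero]
      · rw [max_eq_right h0, max_eq_left (by linarith), zero_sub, neg_neg]
    simp only [Pi.neg_apply]
    conv_rhs => rw [h1]
    push_cast
    ring
  rw [withDensity_eq_iff (hm g hg).coe_nnreal_ennreal (hm (-g) hg.neg).coe_nnreal_ennreal
    (hfin g hg)] at heq
  filter_upwards [heq] with y hy
  have hy' : (g y).toNNReal = (-g y).toNNReal := by exact_mod_cast hy
  have := congrArg NNReal.toReal hy'
  simp only [Real.coe_toNNReal'] at this
  simp only [Pi.zero_apply]
  rcases le_total 0 (g y) with h0 | h0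
  · rw [max_eq_left h0, max_eq_right (by linarith)] at this
    exact this
  · rw [max_eq_right h0, max_eq_left (by linarith)] at this
    linarith

variable (ρ : Measure (Vec d)) [IsProbabilityMeasure ρ]

/-- The inclusion of the reproducing kernel Hilbert space into `L²(ρ)`. -/
noncomputable def rbfToLp (m : ℕ) (σ : ℝ) : RBFSpace d m σ →L[ℝ] Lp (Vec m) 2 ρ :=
  LinearMap.mkContinuous
    { toFun := fun H => (rbfSpace_memLp ρ H).toLp
      map_add' := fun H G => by
        rw [← MemLp.toLp_add]
        exact MemLp.toLp_congr _ _ (by rw [RKHS.coe_add])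
      map_smul' := fun c H => by
        rw [RingHom.id_apply, ← MemLp.toLp_const_smul]
        exact MemLp.toLp_congr _ _ (by rw [RKHS.coe_smul]) }
    1 fun H => by
      have h := Lp.norm_le_of_ae_bound (f := (rbfSpace_memLp ρ H).toLp) (norm_nonneg H) (by
        filter_upwards [(rbfSpace_memLp ρ H).coeFn_toLp] with x hx
        rw [hx]
        exact norm_rbfSpace_apply_le H x)
      simpa [measureUnivNNReal] using h

variable {ρ}

theorem coeFn_rbfToLp (H : RBFSpace d m σ) : rbfToLp ρ m σ H =ᵐ[ρ] fun x => H x :=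
  (rbfSpace_memLp ρ H).coeFn_toLp

theorem inner_rbfToLp (f : Lp (Vec m) 2 ρ) (H : RBFSpace d m σ) :
    inner ℝ f (rbfToLp ρ m σ H) = ∫ x, inner ℝ (f x) (H x) ∂ρ := by
  rw [L2.inner_def]
  refine integral_congr_ae ?_
  filter_upwards [coeFn_rbfToLp (ρ := ρ) H] with x hx
  rw [hx]

/-- A function orthogonal to all `k(·, x) v` has a vanishing Gaussian convolution against `ρ`, so it
is zero. -/
theorem rbfToLp_range_dense (hσ : 0 < σ) :
    (rbfToLp ρ m σ).range.topologicalClosure = ⊤ := by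
  rw [Submodule.topologicalClosure_eq_top_iff, Submodule.eq_bot_iff]
  intro f hf
  have h1 : ∀ x v, ∫ y, rbfKernel σ x y * inner ℝ (f y) v ∂ρ = 0 := fun x v => by
    have h := Submodule.inner_left_of_mem_orthogonal
      (LinearMap.mem_range_self _ (RKHS.kerFun (RBFSpace d m σ) x v)) hf
    erw [inner_rbfToLp] at h
    rw [← h]
    refine integral_congr_ae (ae_of_all _ fun y => ?_)
    simp only [rbfSpace_kerFun_apply, inner_smul_right, rbfKernel_comm σ x y]
  have h2 : ∀ v : Vec m, (fun y => inner ℝ (f y) v) =ᵐ[ρ] (0 : Vec d → ℝ) := fun v => by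
    have hint : Integrable (fun y => (inner ℝ (f y) v : ℝ)) ρ :=
      ((Lp.memLp f).integrable one_le_two).inner_const v
    exact ae_eq_zero_of_integral_char_mul_eq_zero hint
      (integral_char_mul_eq_zero hσ hint fun x => h1 x v)
  rw [Lp.eq_zero_iff_ae_eq_zero]
  have h3 : ∀ᵐ y ∂ρ, ∀ l : Fin m, inner ℝ (f y) (EuclideanSpace.single l (1 : ℝ)) = (0 : ℝ) :=
    ae_all_iff.mpr fun l => h2 _
  filter_upwards [h3] with y hy
  ext l
  have := hy l
  rwa [EuclideanSpace.inner_single_right, one_mul, conj_trivial] at this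

theorem lintegral_enorm_sq_eq_norm_toLp {E : Type*} [NormedAddCommGroup E] {X : Type*}
    [MeasurableSpace X] {μ : Measure X} {f : X → E} (hf : MemLp f 2 μ) :
    ∫⁻ x, ‖f x‖ₑ ^ 2 ∂μ = ENNReal.ofReal (‖hf.toLp‖ ^ 2) := by
  rw [Lp.norm_toLp, ← ENNReal.toReal_pow, ENNReal.ofReal_toReal (ENNReal.pow_ne_top hf.2.ne)]
  rw [eLpNorm_eq_lintegral_rpow_enorm_toReal two_ne_zero ENNReal.ofNat_ne_top]
  simp only [ENNReal.toReal_ofNat, ENNReal.rpow_ofNat]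
  rw [← ENNReal.rpow_natCast, ← ENNReal.rpow_mul]
  simp

theorem lintegral_sub_rbfSpace {u : Vec d → Vec m} (hu : MemLp u 2 ρ) (g : RBFSpace d m σ) :
    ∫⁻ x, ‖u x - g x‖ₑ ^ 2 ∂ρ = ENNReal.ofReal (‖hu.toLp - rbfToLp ρ m σ g‖ ^ 2) := by
  have h2 : MemLp (fun x => u x - g x) 2 ρ := hu.sub (rbfSpace_memLp ρ g)
  have h3 : h2.toLp = hu.toLp - rbfToLp ρ m σ g := MemLp.toLp_sub hu (rbfSpace_memLp ρ g)
  rw [lintegral_enorm_sq_eq_norm_toLp h2, h3]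

theorem exists_rbfSpace_lintegral_lt (hσ : 0 < σ) {u : Vec d → Vec m} (hu : MemLp u 2 ρ)
    {ε : ℝ≥0∞} (hε : 0 < ε) : ∃ g : RBFSpace d m σ, ∫⁻ x, ‖u x - g x‖ₑ ^ 2 ∂ρ < ε := by
  obtain ⟨δ, hδ, hδε⟩ : ∃ δ : ℝ, 0 < δ ∧ ENNReal.ofReal (δ ^ 2) < ε := by
    have hc : Tendsto (fun δ : ℝ => ENNReal.ofReal (δ ^ 2)) (𝓝[>] 0) (𝓝 0) := by
      have : Continuous fun δ : ℝ => ENNReal.ofReal (δ ^ 2) :=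
        ENNReal.continuous_ofReal.comp (by fun_prop)
      simpa using (this.tendsto 0).mono_left nhdsWithin_le_nhds
    obtain ⟨δ, h1, h2⟩ := ((hc.eventually_lt_const hε).and self_mem_nhdsWithin).exists
    exact ⟨δ, h2, h1⟩
  have h1 : hu.toLp ∈ (rbfToLp ρ m σ).range.topologicalClosure := by
    rw [rbfToLp_range_dense hσ]; trivial
  obtain ⟨_, ⟨g, rfl⟩, hg⟩ := Metric.mem_closure_iff.mp h1 δ hδ
  refine ⟨g, lt_of_le_of_lt ?_ hδε⟩
  rw [lintegral_sub_rbfSpace hu, ← dist_eq_norm]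
  exact ENNReal.ofReal_le_ofReal (pow_le_pow_left₀ dist_nonneg hg.le 2)

end Density

/-! ### Mean square consistency -/

section Consistency

theorem lintegral_lintegral_linear {Ω : Type*} [MeasurableSpace Ω] {Q : Measure Ω}
    {X : Type*} [MeasurableSpace X] {ρ : Measure X} [SFinite ρ]
    {A B : Ω → X → ℝ≥0∞} (hB : Measurable (Function.uncurry B)) {a b : ℝ≥0∞} (ha : a ≠ ⊤)
    (hb : b ≠ ⊤) : ∫⁻ ω, ∫⁻ x, (a * A ω x + b * B ω x) ∂ρ ∂Q
      = a * ∫⁻ ω, ∫⁻ x, A ω x ∂ρ ∂Q + b * ∫⁻ ω, ∫⁻ x, B ω x ∂ρ ∂Q := by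
  have h1 : ∀ ω, ∫⁻ x, (a * A ω x + b * B ω x) ∂ρ
      = a * ∫⁻ x, A ω x ∂ρ + b * ∫⁻ x, B ω x ∂ρ := fun ω => by
    rw [lintegral_add_right _ (hB.of_uncurry_left.const_mul b), lintegral_const_mul' _ _ ha,
      lintegral_const_mul' _ _ hb]
  have hB' : Measurable fun ω => ∫⁻ x, B ω x ∂ρ := hB.lintegral_prod_right'
  simp only [h1]
  rw [lintegral_add_right _ (hB'.const_mul b), lintegral_const_mul' _ _ ha,
    lintegral_const_mul' _ _ hb]

variable {d m : ℕ} {σ σn : ℝ} {Ω : Type*} [MeasurableSpace Ω] {P : Measure Ω}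
  [IsProbabilityMeasure P]

/-- For noise-free outputs `u(s)` the prediction converges to `u` in mean square. -/
theorem tendsto_noiseless_error (hσ : 0 < σ) (hσn : 0 < σn) {ρ : Measure (Vec d)}
    [IsProbabilityMeasure ρ] {u : Vec d → Vec m} (hum : Measurable u) (hu : MemLp u 2 ρ)
    {S : ℕ → Ω → Vec d} (hS : ∀ t, Measurable (S t)) (h_law : ∀ t, P.map (S t) = ρ)
    (h_indep : iIndepFun S P) :
    Tendsto (fun N : ℕ => ∫⁻ ω, ∫⁻ x,
      ‖u x - gprTerm σ σn (fun t : Fin N => S t ω) (fun t : Fin N => u (S t ω)) x‖ₑ ^ 2 ∂ρ ∂P)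
      atTop (𝓝 0) := by
  have hF : ∀ N : ℕ, Measurable (Function.uncurry fun (w : Fin N → Vec d) (x : Vec d) =>
      ‖u x - gprTerm σ σn w (fun t => u (w t)) x‖ₑ ^ 2) := fun N => by
    have h1 : Measurable fun p : (Fin N → Vec d) × Vec d =>
        gprTerm σ σn p.1 (fun t => u (p.1 t)) p.2 :=
      measurable_gprTerm hσn measurable_fst (measurable_pi_lambda _ fun t =>
        hum.comp ((measurable_pi_apply t).comp measurable_fst)) measurable_snd
    exact ((hum.comp measurable_snd).sub h1).enorm.pow_const 2
  rw [ENNReal.tendsto_nhds_zero]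
  intro ε hε
  set K := ENNReal.ofReal (((1 + σn ^ 2) / σn ^ 2) ^ 2) with hK
  obtain ⟨g, hg⟩ := exists_rbfSpace_lintegral_lt (m := m) hσ hu
    (ENNReal.div_pos hε.ne' (ENNReal.ofReal_ne_top : K ≠ ⊤))
  set I := ∫⁻ x, ‖u x - g x‖ₑ ^ 2 ∂ρ with hI
  have hlim : Tendsto (fun N : ℕ => K * (ENNReal.ofReal (σn ^ 2 * ‖g‖ ^ 2) / (N + 1 : ℕ) + I))
      atTop (𝓝 (K * (0 + I))) := by
    refine ENNReal.Tendsto.const_mul (Tendsto.add ?_ tendsto_const_nhds)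
      (Or.inr ENNReal.ofReal_ne_top)
    have h := (tendsto_add_atTop_iff_nat 1).mpr (ENNReal.Tendsto.const_div
      ENNReal.tendsto_nat_nhds_top
      (Or.inr (ENNReal.ofReal_ne_top (r := σn ^ 2 * ‖g‖ ^ 2))))
    rwa [ENNReal.div_top] at h
  rw [zero_add] at hlim
  filter_upwards [hlim.eventually_lt_const (ENNReal.mul_lt_of_lt_div' hg)] with N hN
  rw [lintegral_sample_test hS h_law h_indep (hF N)]
  exact (lintegral_noiseless_error_le hσn ρ hum g).trans hN.le

/-- The contribution of centred noise to the prediction vanishes in mean square. The inner integral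
runs over pairs `z`, of which only the input enters. -/
theorem tendsto_noise (hσn : 0 < σn) {μ : Measure (Vec d × Vec m)} [IsProbabilityMeasure μ]
    {ξ : Vec d × Vec m → Vec m} (hξm : Measurable ξ) (hξ : MemLp ξ 2 μ)
    (h0 : ∀ h : Vec d → ℝ, Measurable h → (∃ M, ∀ x, |h x| ≤ M) → ∫ z, h z.1 • ξ z ∂μ = 0)
    {T : ℕ → Ω → Vec d × Vec m} (hT : ∀ t, Measurable (T t)) (h_law : ∀ t, P.map (T t) = μ)
    (h_indep : iIndepFun T P) :
    Tendsto (fun N : ℕ => ∫⁻ ω, ∫⁻ z, ‖gprTerm σ σn (fun t : Fin N => (T t ω).1)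
      (fun t : Fin N => ξ (T t ω)) z.1‖ₑ ^ 2 ∂μ ∂P) atTop (𝓝 0) := by
  have hinp : ∀ N : ℕ, Measurable fun p : (Fin N → Vec d × Vec m) × (Vec d × Vec m) =>
      fun t => (p.1 t).1 := fun N => by fun_prop
  have hF : ∀ N : ℕ, Measurable (Function.uncurry
      fun (w : Fin N → Vec d × Vec m) (z : Vec d × Vec m) =>
      ‖gprTerm σ σn (fun t => (w t).1) (fun t => ξ (w t)) z.1‖ₑ ^ 2) := fun N => by
    have h1 : Measurable fun p : (Fin N → Vec d × Vec m) × (Vec d × Vec m) =>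
        gprTerm σ σn (fun t => (p.1 t).1) (fun t => ξ (p.1 t)) p.2.1 :=
      measurable_gprTerm hσn (hinp N) (measurable_pi_lambda _ fun t =>
        hξm.comp ((measurable_pi_apply t).comp measurable_fst)) (measurable_fst.comp measurable_snd)
    exact h1.enorm.pow_const 2
  set G : (N : ℕ) → (Fin N → Vec d × Vec m) → Vec d × Vec m → ℝ≥0∞ := fun N w z =>
    ‖ξ z‖ₑ ^ 2 * ∑ i, ‖gprWeight σ σn (fun t => (w t).1) z.1 i‖ₑ ^ 2 with hG
  have hGm : ∀ N, Measurable (Function.uncurry (G N)) := fun N =>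
    ((hξm.comp measurable_snd).enorm.pow_const 2).mul (Finset.measurable_fun_sum _ fun i _ =>
      (measurable_gprWeight hσn (hinp N) (measurable_fst.comp measurable_snd) i).enorm.pow_const 2)
  have hGeq : ∀ N w z, G N w z = ‖ξ z‖ₑ ^ 2 * ENNReal.ofReal
      (gprWeight σ σn (fun t => (w t).1) z.1 ⬝ᵥ gprWeight σ σn (fun t => (w t).1) z.1) :=
    fun N w z => by
    simp only [hG, enorm_sq_eq_ofReal, dotProduct, Real.norm_eq_abs, sq_abs]
    rw [← ENNReal.ofReal_sum_of_nonneg fun i _ => sq_nonneg _]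
    simp only [sq]
  have hGle : ∀ N w z, G N w z ≤ ‖ξ z‖ₑ ^ 2 * ENNReal.ofReal ((σn ^ 2)⁻¹) := fun N w z => by
    rw [hGeq]
    gcongr
    exact gprWeight_sq_le hσn _ _
  have hbound : ∫⁻ z, ‖ξ z‖ₑ ^ 2 * ENNReal.ofReal ((σn ^ 2)⁻¹) ∂μ ≠ ⊤ := by
    rw [lintegral_mul_const' _ _ ENNReal.ofReal_ne_top, lintegral_enorm_sq_eq_norm_toLp hξ]
    exact ENNReal.mul_ne_top ENNReal.ofReal_ne_top ENNReal.ofReal_ne_top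
  have hfst : ∀ t, Measurable fun ω => (T t ω).1 := fun t => measurable_fst.comp (hT t)
  have hrec := ae_frequently_mem_nhds (P := P) (ρ := μ.map Prod.fst) hfst
    (fun t => by rw [← h_law t, Measure.map_map measurable_fst (hT t)]; rfl)
    (h_indep.comp (fun _ => Prod.fst) fun _ => measurable_fst)
  -- dominated convergence, over the test pair for almost every sample, then over the sample
  have hinner : ∀ᵐ ω ∂P, Tendsto (fun N : ℕ => ∫⁻ z, G N (fun t => T t ω) z ∂μ) atTop (𝓝 0) := by
    filter_upwards [hrec] with ω hω
    rw [← lintegral_zero (μ := μ)]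
    refine tendsto_lintegral_of_dominated_convergence _ (fun N => (hGm N).of_uncurry_left)
      (fun N => ae_of_all _ fun z => hGle N _ z) hbound ?_
    filter_upwards [ae_of_ae_map measurable_fst.aemeasurable hω] with z hz
    simp only [hGeq]
    have h := tendsto_gprWeight_sq (σ := σ) hσn (fun t => (T t ω).1) z.1 hz
    have h' := ENNReal.Tendsto.const_mul (ENNReal.tendsto_ofReal h)
      (Or.inr (ENNReal.pow_ne_top (enorm_ne_top (x := ξ z)) (n := 2)))
    rwa [ENNReal.ofReal_zero, mul_zero] at h'
  have houter : Tendsto (fun N : ℕ => ∫⁻ ω, ∫⁻ z, G N (fun t => T t ω) z ∂μ ∂P) atTop (𝓝 0) := by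
    rw [← lintegral_zero (μ := P)]
    refine tendsto_lintegral_of_dominated_convergence
      (fun _ => ∫⁻ z, ‖ξ z‖ₑ ^ 2 * ENNReal.ofReal ((σn ^ 2)⁻¹) ∂μ) (fun N => ?_)
      (fun N => ae_of_all _ fun ω => lintegral_mono fun z => hGle N _ z) (by simpa using hbound)
      hinner
    have h1 : Measurable fun w : Fin N → Vec d × Vec m => ∫⁻ z, G N w z ∂μ :=
      (hGm N).lintegral_prod_right'
    exact h1.comp (by fun_prop)
  have hlim := ENNReal.Tendsto.const_mul
    (a := ENNReal.ofReal (((1 + σn ^ 2) / σn ^ 2) ^ 2)) houter (Or.inr ENNReal.ofReal_ne_top)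
  rw [mul_zero] at hlim
  refine tendsto_of_tendsto_of_tendsto_of_le_of_le tendsto_const_nhds hlim (fun N => zero_le)
    fun N => ?_
  simp only
  rw [lintegral_sample_test hT h_law h_indep (hF N), lintegral_sample_test hT h_law h_indep (hGm N)]
  exact lintegral_noise_le hσn hξm hξ h0

theorem enorm_add_sq_le {E : Type*} [SeminormedAddCommGroup E] (a b : E) :
    ‖a + b‖ₑ ^ 2 ≤ 2 * ‖a‖ₑ ^ 2 + 2 * ‖b‖ₑ ^ 2 := by
  have h : ‖a + b‖ ^ 2 ≤ 2 * ‖a‖ ^ 2 + 2 * ‖b‖ ^ 2 := by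
    have h1 := norm_add_le a b
    nlinarith [sq_nonneg (‖a‖ - ‖b‖), norm_nonneg (a + b), norm_nonneg a, norm_nonneg b]
  rw [enorm_sq_eq_ofReal, enorm_sq_eq_ofReal, enorm_sq_eq_ofReal]
  calc ENNReal.ofReal (‖a + b‖ ^ 2) ≤ ENNReal.ofReal (2 * ‖a‖ ^ 2 + 2 * ‖b‖ ^ 2) :=
        ENNReal.ofReal_le_ofReal h
    _ = _ := by
        rw [ENNReal.ofReal_add (by positivity) (by positivity), ENNReal.ofReal_mul (by norm_num),
          ENNReal.ofReal_mul (by norm_num)]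
        simp

theorem gprTerm_sub {N : ℕ} (S : Fin N → Vec d) (Y Z : Fin N → Vec m) (s : Vec d) :
    gprTerm σ σn S (fun t => Y t - Z t) s = gprTerm σ σn S Y s - gprTerm σ σn S Z s := by
  simp only [gprTerm_eq_sum, smul_sub, Finset.sum_sub_distrib]

theorem gprTerm_map {N : ℕ} {m' : ℕ} (W : Vec m' →L[ℝ] Vec m) (S : Fin N → Vec d)
    (Y : Fin N → Vec m') (s : Vec d) :
    gprTerm σ σn S (fun t => W (Y t)) s = W (gprTerm σ σn S Y s) := by
  simp only [gprTerm_eq_sum, map_sum, map_smul]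

theorem memLp_regression {μ : Measure (Vec d × Vec m)} {η : Vec d → Vec m}
    (hR : MemLp Prod.snd 2 μ) (hη : Measurable η)
    (hη_cond : (fun z => η z.1) =ᵐ[μ]
      μ[(Prod.snd : Vec d × Vec m → Vec m) |
        MeasurableSpace.comap (Prod.fst : Vec d × Vec m → Vec d) inferInstance]) :
    MemLp η 2 (μ.map Prod.fst) := by
  rw [memLp_map_measure_iff hη.aestronglyMeasurable measurable_fst.aemeasurable]
  exact (memLp_congr_ae hη_cond).mpr (hR.condExp one_le_two)

section Regression

variable {μ : Measure (Vec d × Vec m)} [IsProbabilityMeasure μ] {η : Vec d → Vec m}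

/-- The residual `r - η(s)` is centred given `s`: the pull-out property of the conditional
expectation. -/
theorem integral_smul_residual_eq_zero (hR : MemLp Prod.snd 2 μ)
    (hη_cond : (fun z => η z.1) =ᵐ[μ]
      μ[(Prod.snd : Vec d × Vec m → Vec m) |
        MeasurableSpace.comap (Prod.fst : Vec d × Vec m → Vec d) inferInstance])
    (h : Vec d → ℝ) (hm : Measurable h) (hb : ∃ M, ∀ x, |h x| ≤ M) :
    ∫ z, h z.1 • (z.2 - η z.1) ∂μ = 0 := by
  obtain ⟨M, hM⟩ := hb
  have hle : MeasurableSpace.comap (Prod.fst : Vec d × Vec m → Vec d) inferInstance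
      ≤ (inferInstance : MeasurableSpace (Vec d × Vec m)) := measurable_fst.comap_le
  have hR1 : Integrable (Prod.snd : Vec d × Vec m → Vec m) μ := hR.integrable one_le_two
  have hη1 : Integrable (fun z : Vec d × Vec m => η z.1) μ := integrable_condExp.congr hη_cond.symm
  have hhm : AEStronglyMeasurable (fun z : Vec d × Vec m => h z.1) μ :=
    (hm.comp measurable_fst).aestronglyMeasurable
  have hi1 : Integrable ((fun z : Vec d × Vec m => h z.1) • (Prod.snd : Vec d × Vec m → Vec m)) μ :=
    hR1.bdd_smul M hhm (ae_of_all _ fun z => hM _)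
  have hi2 : Integrable (fun z : Vec d × Vec m => h z.1 • η z.1) μ :=
    hη1.bdd_smul M hhm (ae_of_all _ fun z => hM _)
  have hsm : StronglyMeasurable[MeasurableSpace.comap (Prod.fst : Vec d × Vec m → Vec d)
      inferInstance] (fun z : Vec d × Vec m => h z.1) :=
    (hm.comp (comap_measurable Prod.fst)).stronglyMeasurable
  have hpull := condExp_smul_of_aestronglyMeasurable_left hsm.aestronglyMeasurable hi1 hR1
  have h1 : ∫ z, h z.1 • z.2 ∂μ = ∫ z, h z.1 • η z.1 ∂μ := by
    rw [← integral_condExp hle (f := fun z : Vec d × Vec m => h z.1 • z.2)]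
    refine integral_congr_ae ?_
    filter_upwards [hpull, hη_cond] with z hz1 hz2
    refine hz1.trans ?_
    rw [Pi.smul_apply', ← hz2]
  have hi1' : Integrable (fun z : Vec d × Vec m => h z.1 • z.2) μ := hi1
  simp only [smul_sub]
  rw [integral_sub hi1' hi2, sub_eq_zero]
  exact h1

/-- The error splits into that of the noise-free outputs `η(s)` and the contribution of the noise
`r - η(s)`. -/
theorem tendsto_gprTerm_regression (hσ : 0 < σ) (hσn : 0 < σn) (hR : MemLp Prod.snd 2 μ)
    (hη : Measurable η)
    (hη_cond : (fun z => η z.1) =ᵐ[μ]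
      μ[(Prod.snd : Vec d × Vec m → Vec m) |
        MeasurableSpace.comap (Prod.fst : Vec d × Vec m → Vec d) inferInstance])
    {S : ℕ → Ω → Vec d} {R : ℕ → Ω → Vec m} (hS_meas : ∀ t, Measurable (S t))
    (hR_meas : ∀ t, Measurable (R t)) (h_law : ∀ t, P.map (fun ω => (S t ω, R t ω)) = μ)
    (h_indep : iIndepFun (fun t ω => (S t ω, R t ω)) P) :
    Tendsto (fun N : ℕ => ∫⁻ ω, ∫⁻ x,
      ‖gprTerm σ σn (fun t : Fin N => S t ω) (fun t : Fin N => R t ω) x - η x‖ₑ ^ 2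
        ∂(μ.map Prod.fst) ∂P) atTop (𝓝 0) := by
  have : IsProbabilityMeasure (μ.map Prod.fst) :=
    Measure.isProbabilityMeasure_map measurable_fst.aemeasurable
  have hT : ∀ t, Measurable fun ω => (S t ω, R t ω) := fun t => (hS_meas t).prodMk (hR_meas t)
  have hS_law : ∀ t, P.map (S t) = μ.map Prod.fst := fun t => by
    rw [← h_law t, Measure.map_map measurable_fst (hT t)]; rfl
  have hS_indep : iIndepFun S P := h_indep.comp (fun _ => Prod.fst) fun _ => measurable_fst
  have hηLp := memLp_regression hR hη hη_cond
  have hξm : Measurable fun z : Vec d × Vec m => z.2 - η z.1 :=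
    measurable_snd.sub (hη.comp measurable_fst)
  have hξ : MemLp (fun z : Vec d × Vec m => z.2 - η z.1) 2 μ := hR.sub
    ((memLp_map_measure_iff hη.aestronglyMeasurable measurable_fst.aemeasurable).mp hηLp)
  have h1 := tendsto_noiseless_error hσ hσn hη hηLp hS_meas hS_law hS_indep
  have h2 := tendsto_noise (σ := σ) hσn hξm hξ (integral_smul_residual_eq_zero hR hη_cond) hT h_law
    h_indep
  have h3 := (ENNReal.Tendsto.const_mul (a := 2) h1 (Or.inr ENNReal.ofNat_ne_top)).add
    (ENNReal.Tendsto.const_mul (a := 2) h2 (Or.inr ENNReal.ofNat_ne_top))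
  simp only [mul_zero, add_zero] at h3
  refine tendsto_of_tendsto_of_tendsto_of_le_of_le tendsto_const_nhds h3 (fun N => zero_le)
    fun N => ?_
  have hterm : ∀ (Y : (Ω → Fin N → Vec m)), Measurable Y → Measurable fun p : Ω × Vec d =>
      gprTerm σ σn (fun t : Fin N => S t p.1) (Y p.1) p.2 := fun Y hY =>
    measurable_gprTerm hσn (measurable_pi_lambda _ fun t => (hS_meas t).comp measurable_fst)
      (hY.comp measurable_fst) measurable_snd
  have hm2 : Measurable (Function.uncurry fun (ω : Ω) (x : Vec d) =>
      ‖gprTerm σ σn (fun t : Fin N => S t ω) (fun t : Fin N => R t ω - η (S t ω)) x‖ₑ ^ 2) :=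
    (hterm (fun ω t => R t ω - η (S t ω)) (measurable_pi_lambda _ fun t =>
      (hR_meas t).sub (hη.comp (hS_meas t)))).enorm.pow_const 2
  calc ∫⁻ ω, ∫⁻ x, ‖gprTerm σ σn (fun t : Fin N => S t ω) (fun t : Fin N => R t ω) x - η x‖ₑ ^ 2
        ∂(μ.map Prod.fst) ∂P
      ≤ ∫⁻ ω, ∫⁻ x, (2 * ‖η x - gprTerm σ σn (fun t : Fin N => S t ω)
          (fun t : Fin N => η (S t ω)) x‖ₑ ^ 2
        + 2 * ‖gprTerm σ σn (fun t : Fin N => S t ω)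
          (fun t : Fin N => R t ω - η (S t ω)) x‖ₑ ^ 2) ∂(μ.map Prod.fst) ∂P := by
        refine lintegral_mono fun ω => lintegral_mono fun x => ?_
        rw [← enorm_neg (η x - _)]
        refine le_trans (le_of_eq ?_) (enorm_add_sq_le _ _)
        rw [gprTerm_sub]
        congr 2
        abel
    _ = _ := by
        have hi : ∀ ω, ∫⁻ x, ‖gprTerm σ σn (fun t : Fin N => S t ω)
            (fun t : Fin N => R t ω - η (S t ω)) x‖ₑ ^ 2 ∂(μ.map Prod.fst)
            = ∫⁻ z, ‖gprTerm σ σn (fun t : Fin N => S t ω)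
              (fun t : Fin N => R t ω - η (S t ω)) z.1‖ₑ ^ 2 ∂μ := fun ω =>
          lintegral_map hm2.of_uncurry_left measurable_fst
        simp only [← hi]
        exact lintegral_lintegral_linear hm2 ENNReal.ofNat_ne_top ENNReal.ofNat_ne_top

/-- The part of the error that involves `W` is `W (s - H^S(s))`, where `H^S` is the prediction from
the noise-free outputs of the identity function. -/
theorem tendsto_gprMean_regression (hσ : 0 < σ) (hσn : 0 < σn) (hR : MemLp Prod.snd 2 μ)
    (hη : Measurable η)
    (hη_cond : (fun z => η z.1) =ᵐ[μ]
      μ[(Prod.snd : Vec d × Vec m → Vec m) |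
        MeasurableSpace.comap (Prod.fst : Vec d × Vec m → Vec d) inferInstance])
    {S : ℕ → Ω → Vec d} {R : ℕ → Ω → Vec m} (hS_meas : ∀ t, Measurable (S t))
    (hR_meas : ∀ t, Measurable (R t)) (h_law : ∀ t, P.map (fun ω => (S t ω, R t ω)) = μ)
    (h_indep : iIndepFun (fun t ω => (S t ω, R t ω)) P) (hS : MemLp Prod.fst 2 μ) (C : ℝ) :
    Tendsto (fun N : ℕ => ∫⁻ ω, ⨆ (W : Vec d →L[ℝ] Vec m) (_ : ‖W‖ ≤ C), ∫⁻ x,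
      ‖gprMean σ σn W (fun t : Fin N => S t ω) (fun t : Fin N => R t ω) x - η x‖ₑ ^ 2
        ∂(μ.map Prod.fst) ∂P) atTop (𝓝 0) := by
  have : IsProbabilityMeasure (μ.map Prod.fst) :=
    Measure.isProbabilityMeasure_map measurable_fst.aemeasurable
  have hT : ∀ t, Measurable fun ω => (S t ω, R t ω) := fun t => (hS_meas t).prodMk (hR_meas t)
  have hS_law : ∀ t, P.map (S t) = μ.map Prod.fst := fun t => by
    rw [← h_law t, Measure.map_map measurable_fst (hT t)]; rfl
  have hS_indep : iIndepFun S P := h_indep.comp (fun _ => Prod.fst) fun _ => measurable_fst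
  have hid : MemLp (fun x : Vec d => x) 2 (μ.map Prod.fst) :=
    (memLp_map_measure_iff measurable_id.aestronglyMeasurable measurable_fst.aemeasurable).mpr hS
  have h1 := tendsto_noiseless_error hσ hσn measurable_id' hid hS_meas hS_law hS_indep
  have h2 := tendsto_gprTerm_regression hσ hσn hR hη hη_cond hS_meas hR_meas h_law h_indep
  have h3 := (ENNReal.Tendsto.const_mul (a := 2) h2 (Or.inr ENNReal.ofNat_ne_top)).add
    (ENNReal.Tendsto.const_mul (a := 2 * ENNReal.ofReal (C ^ 2)) h1
      (Or.inr (ENNReal.mul_ne_top ENNReal.ofNat_ne_top ENNReal.ofReal_ne_top)))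
  simp only [mul_zero, add_zero] at h3
  refine tendsto_of_tendsto_of_tendsto_of_le_of_le tendsto_const_nhds h3 (fun N => zero_le)
    fun N => ?_
  have hm1 : Measurable (Function.uncurry fun (ω : Ω) (x : Vec d) =>
      ‖x - gprTerm σ σn (fun t : Fin N => S t ω) (fun t : Fin N => S t ω) x‖ₑ ^ 2) := by
    have hSm : Measurable fun (p : Ω × Vec d) (t : Fin N) => S t p.1 :=
      measurable_pi_lambda _ fun t => (hS_meas t).comp measurable_fst
    exact (measurable_snd.sub
      (measurable_gprTerm hσn hSm hSm measurable_snd)).enorm.pow_const 2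
  calc ∫⁻ ω, ⨆ (W : Vec d →L[ℝ] Vec m) (_ : ‖W‖ ≤ C), ∫⁻ x,
      ‖gprMean σ σn W (fun t : Fin N => S t ω) (fun t : Fin N => R t ω) x - η x‖ₑ ^ 2
        ∂(μ.map Prod.fst) ∂P
      ≤ ∫⁻ ω, ∫⁻ x, (2 * ‖gprTerm σ σn (fun t : Fin N => S t ω) (fun t : Fin N => R t ω) x
            - η x‖ₑ ^ 2
          + 2 * ENNReal.ofReal (C ^ 2) * ‖x - gprTerm σ σn (fun t : Fin N => S t ω)
            (fun t : Fin N => S t ω) x‖ₑ ^ 2) ∂(μ.map Prod.fst) ∂P := by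
        refine lintegral_mono fun ω => iSup₂_le fun W hW => lintegral_mono fun x => ?_
        have hsplit : gprMean σ σn W (fun t : Fin N => S t ω) (fun t : Fin N => R t ω) x - η x
            = (gprTerm σ σn (fun t : Fin N => S t ω) (fun t : Fin N => R t ω) x - η x)
              + W (x - gprTerm σ σn (fun t : Fin N => S t ω) (fun t : Fin N => S t ω) x) := by
          rw [gprMean, gprTerm_sub, gprTerm_map, map_sub]
          abel
        rw [hsplit, mul_assoc]
        refine (enorm_add_sq_le _ _).trans ?_
        gcongr
        rw [enorm_sq_eq_ofReal, enorm_sq_eq_ofReal, ← ENNReal.ofReal_mul (sq_nonneg _), ← mul_pow]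
        refine ENNReal.ofReal_le_ofReal (pow_le_pow_left₀ (norm_nonneg _) ?_ 2)
        exact (W.le_opNorm _).trans (mul_le_mul_of_nonneg_right hW (norm_nonneg _))
    _ = _ := lintegral_lintegral_linear hm1 ENNReal.ofNat_ne_top
        (ENNReal.mul_ne_top ENNReal.ofNat_ne_top ENNReal.ofReal_ne_top)

end Regression

end Consistency

/-! ### The expected functional -/

section Tikhonov

variable {V W : Type*} [NormedAddCommGroup V] [InnerProductSpace ℝ V] [NormedAddCommGroup W]
  [InnerProductSpace ℝ W]

/-- The first-order condition for a minimizer of `‖G‖² + c ‖y - T G‖²` has a solution, by the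
Lax–Milgram theorem. -/
theorem exists_tikhonov_normal_equation [CompleteSpace V] (T : V →L[ℝ] W) (y : W) {c : ℝ}
    (hc : 0 ≤ c) :
    ∃ H : V, ∀ G, inner ℝ H G + c * inner ℝ (T H - y) (T G) = 0 := by
  let B : V →L[ℝ] V →L[ℝ] ℝ := LinearMap.mkContinuous₂
    (LinearMap.mk₂ ℝ (fun u v => inner ℝ u v + c * inner ℝ (T u) (T v))
      (fun u u' v => by simp only [map_add, inner_add_left]; ring)
      (fun a u v => by simp only [map_smul, real_inner_smul_left, smul_eq_mul]; ring)
      (fun u v v' => by simp only [map_add, inner_add_right]; ring)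
      (fun a u v => by simp only [map_smul, real_inner_smul_right, smul_eq_mul]; ring))
    (1 + c * ‖T‖ ^ 2) fun u v => by
      have h1 := norm_inner_le_norm (𝕜 := ℝ) u v
      have h2 := norm_inner_le_norm (𝕜 := ℝ) (T u) (T v)
      have h3 : ‖T u‖ * ‖T v‖ ≤ (‖T‖ * ‖u‖) * (‖T‖ * ‖v‖) :=
        mul_le_mul (T.le_opNorm u) (T.le_opNorm v) (norm_nonneg _) (by positivity)
      calc ‖inner ℝ u v + c * inner ℝ (T u) (T v)‖
          ≤ ‖inner ℝ u v‖ + ‖c * inner ℝ (T u) (T v)‖ := norm_add_le _ _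
        _ ≤ ‖u‖ * ‖v‖ + c * ((‖T‖ * ‖u‖) * (‖T‖ * ‖v‖)) := by
            rw [norm_mul, Real.norm_of_nonneg hc]
            exact add_le_add h1 (mul_le_mul_of_nonneg_left (h2.trans h3) hc)
        _ = _ := by ring
  have hB : ∀ u v, B u v = inner ℝ u v + c * inner ℝ (T u) (T v) := fun u v => rfl
  have hcoer : IsCoercive B := ⟨1, one_pos, fun u => by
    rw [hB, real_inner_self_eq_norm_sq, real_inner_self_eq_norm_sq]
    nlinarith [mul_nonneg hc (sq_nonneg ‖T u‖)]⟩
  let ℓ : V →L[ℝ] ℝ := c • (innerSL ℝ y).comp T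
  refine ⟨hcoer.continuousLinearEquivOfBilin.symm ((InnerProductSpace.toDual ℝ V).symm ℓ),
    fun G => ?_⟩
  set H := hcoer.continuousLinearEquivOfBilin.symm ((InnerProductSpace.toDual ℝ V).symm ℓ) with hH
  have h1 := hcoer.continuousLinearEquivOfBilin_apply H G
  rw [hH, ContinuousLinearEquiv.apply_symm_apply, ← hH, InnerProductSpace.toDual_symm_apply,
    hB] at h1
  have h2 : ℓ G = c * inner ℝ y (T G) := rfl
  rw [inner_sub_left]
  linarith

/-- A solution `H` of the normal equation is the vertex of the quadratic functional
`‖G‖² + c ‖y - T G‖²`. -/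
theorem tikhonov_eq_add (T : V →L[ℝ] W) (y : W) {c : ℝ} {H : V}
    (hH : ∀ G, inner ℝ H G + c * inner ℝ (T H - y) (T G) = 0) (G : V) :
    ‖G‖ ^ 2 + c * ‖y - T G‖ ^ 2 = ‖H‖ ^ 2 + c * ‖y - T H‖ ^ 2
      + (‖G - H‖ ^ 2 + c * ‖T (G - H)‖ ^ 2) := by
  obtain ⟨D, rfl⟩ : ∃ D, G = H + D := ⟨G - H, by abel⟩
  rw [add_sub_cancel_left, norm_add_sq_real, norm_sub_rev y, norm_sub_rev y,
    show T (H + D) - y = (T H - y) + T D by rw [map_add]; abel, norm_add_sq_real]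
  linarith [hH D]

end Tikhonov

section Expected

variable {d m : ℕ} {σ σn : ℝ} {μ : Measure (Vec d × Vec m)} [IsProbabilityMeasure μ]
  {η : Vec d → Vec m}

theorem rbfSpace_comp_fst_memLp (H : RBFSpace d m σ) :
    MemLp (fun z : Vec d × Vec m => H z.1) 2 μ :=
  MemLp.of_bound ((continuous_rbfSpace H).comp continuous_fst).aestronglyMeasurable ‖H‖
    (ae_of_all _ fun z => norm_rbfSpace_apply_le H z.1)

/-- Up to a constant, the risk of `H` is the squared `L²(ρ)` distance of `H` to the regression
function. -/
theorem integral_risk_eq [IsProbabilityMeasure (μ.map Prod.fst)] (hR : MemLp Prod.snd 2 μ)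
    (hη : Measurable η)
    (hη_cond : (fun z => η z.1) =ᵐ[μ]
      μ[(Prod.snd : Vec d × Vec m → Vec m) |
        MeasurableSpace.comap (Prod.fst : Vec d × Vec m → Vec d) inferInstance])
    (hηLp : MemLp η 2 (μ.map Prod.fst)) (H : RBFSpace d m σ) :
    ∫ z, ‖z.2 - H z.1‖ ^ 2 ∂μ = ‖hηLp.toLp - rbfToLp (μ.map Prod.fst) m σ H‖ ^ 2
      + (∫ z, ‖z.2‖ ^ 2 ∂μ - ‖hηLp.toLp‖ ^ 2) := by
  have hHm : Measurable fun x => H x := (continuous_rbfSpace H).measurable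
  have hHLp := rbfSpace_comp_fst_memLp (μ := μ) H
  have hηLp' : MemLp (fun z : Vec d × Vec m => η z.1) 2 μ :=
    (memLp_map_measure_iff hη.aestronglyMeasurable measurable_fst.aemeasurable).mp hηLp
  have hξLp : MemLp (fun z : Vec d × Vec m => z.2 - η z.1) 2 μ := hR.sub hηLp'
  have h1 : ∫ z, inner ℝ (z.2 - η z.1) (H z.1) ∂μ = 0 := by
    have h2 : ∀ l : Fin m, Integrable (fun z : Vec d × Vec m => H z.1 l • (z.2 - η z.1)) μ :=
      fun l => (hξLp.integrable one_le_two).bdd_smul ‖H‖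
        (((EuclideanSpace.proj (𝕜 := ℝ) l).continuous.measurable.comp
          hHm).comp measurable_fst).aestronglyMeasurable
        (ae_of_all _ fun z => (PiLp.norm_apply_le _ l).trans (norm_rbfSpace_apply_le H z.1))
    have h3 : ∀ l : Fin m, ∫ z, H z.1 l * (z.2 - η z.1) l ∂μ = 0 := fun l => by
      have h4 := integral_smul_residual_eq_zero hR hη_cond (fun x => H x l)
        ((EuclideanSpace.proj (𝕜 := ℝ) l).continuous.measurable.comp hHm)
        ⟨‖H‖, fun x => (PiLp.norm_apply_le _ l).trans (norm_rbfSpace_apply_le H x)⟩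
      have h5 := (EuclideanSpace.proj (𝕜 := ℝ) l).integral_comp_comm (h2 l)
      rw [h4, map_zero] at h5
      exact h5
    have h6 : ∀ z : Vec d × Vec m, inner ℝ (z.2 - η z.1) (H z.1)
        = ∑ l, H z.1 l * (z.2 - η z.1) l := fun z => by
      rw [PiLp.inner_apply]
      rfl
    have h7 : ∀ l : Fin m, Integrable (fun z : Vec d × Vec m => H z.1 l * (z.2 - η z.1) l) μ :=
      fun l => (EuclideanSpace.proj (𝕜 := ℝ) l).integrable_comp (h2 l)
    simp only [h6]
    rw [integral_finsetSum _ fun l _ => h7 l]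
    exact Finset.sum_eq_zero fun l _ => h3 l
  have h7 : ∫ z, inner ℝ z.2 (H z.1) ∂μ = inner ℝ hηLp.toLp (rbfToLp (μ.map Prod.fst) m σ H) := by
    rw [inner_rbfToLp]
    have h8 : ∫ x, inner ℝ (hηLp.toLp η x) (H x) ∂(μ.map Prod.fst)
        = ∫ x, inner ℝ (η x) (H x) ∂(μ.map Prod.fst) := by
      refine integral_congr_ae ?_
      filter_upwards [hηLp.coeFn_toLp] with x hx
      rw [hx]
    rw [h8, integral_map measurable_fst.aemeasurable (hη.inner hHm).aestronglyMeasurable,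
      ← sub_eq_zero, ← integral_sub (hR.integrable_inner_of_two hHLp)
        (hηLp'.integrable_inner_of_two hHLp), ← h1]
    simp only [inner_sub_left]
  have h9 : ∫ z, ‖H z.1‖ ^ 2 ∂μ = ‖rbfToLp (μ.map Prod.fst) m σ H‖ ^ 2 := by
    rw [← real_inner_self_eq_norm_sq, inner_rbfToLp]
    have h8 : ∫ x, inner ℝ (rbfToLp (μ.map Prod.fst) m σ H x) (H x) ∂(μ.map Prod.fst)
        = ∫ x, ‖H x‖ ^ 2 ∂(μ.map Prod.fst) := by
      refine integral_congr_ae ?_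
      filter_upwards [coeFn_rbfToLp (ρ := μ.map Prod.fst) H] with x hx
      rw [hx, real_inner_self_eq_norm_sq]
    rw [h8, integral_map measurable_fst.aemeasurable (hHm.norm.pow_const 2).aestronglyMeasurable]
  have hexp : ∀ z : Vec d × Vec m, ‖z.2 - H z.1‖ ^ 2
      = ‖z.2‖ ^ 2 - 2 * inner ℝ z.2 (H z.1) + ‖H z.1‖ ^ 2 := fun z => norm_sub_sq_real _ _
  have hi1 : Integrable (fun z : Vec d × Vec m => ‖z.2‖ ^ 2) μ := hR.integrable_norm_pow two_ne_zero
  have hi2 : Integrable (fun z : Vec d × Vec m => 2 * inner ℝ z.2 (H z.1)) μ :=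
    (hR.integrable_inner_of_two hHLp).const_mul 2
  have hi3 : Integrable (fun z : Vec d × Vec m => ‖H z.1‖ ^ 2) μ :=
    hHLp.integrable_norm_pow two_ne_zero
  simp only [hexp]
  have hi12 : Integrable (fun z : Vec d × Vec m => ‖z.2‖ ^ 2 - 2 * inner ℝ z.2 (H z.1)) μ :=
    hi1.sub hi2
  rw [integral_add hi12 hi3, integral_sub hi1 hi2, integral_const_mul, h7, h9,
    norm_sub_sq_real]
  ring

theorem integral_gprFunctional {Ω : Type*} [MeasurableSpace Ω] {P : Measure Ω}
    [IsProbabilityMeasure P] (hR : MemLp Prod.snd 2 μ) {S : ℕ → Ω → Vec d} {R : ℕ → Ω → Vec m}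
    (hS_meas : ∀ t, Measurable (S t)) (hR_meas : ∀ t, Measurable (R t))
    (h_law : ∀ t, P.map (fun ω => (S t ω, R t ω)) = μ) (N : ℕ) (H : RBFSpace d m σ) :
    ∫ ω, gprFunctional σn (fun t : Fin N => S t ω) (fun t : Fin N => R t ω) H ∂P
      = 1 / 2 * ‖H‖ ^ 2 + 1 / (2 * σn ^ 2) * (N * ∫ z, ‖z.2 - H z.1‖ ^ 2 ∂μ) := by
  have hT : ∀ t, Measurable fun ω => (S t ω, R t ω) := fun t => (hS_meas t).prodMk (hR_meas t)
  have hi : Integrable (fun z : Vec d × Vec m => ‖z.2 - H z.1‖ ^ 2) μ :=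
    (hR.sub (rbfSpace_comp_fst_memLp H)).integrable_norm_pow two_ne_zero
  have hit : ∀ t, Integrable (fun ω => ‖R t ω - H (S t ω)‖ ^ 2) P := fun t => by
    rw [← h_law t] at hi
    exact hi.comp_measurable (hT t)
  have heq : ∀ t, ∫ ω, ‖R t ω - H (S t ω)‖ ^ 2 ∂P = ∫ z, ‖z.2 - H z.1‖ ^ 2 ∂μ := fun t => by
    have hi' := hi.aestronglyMeasurable
    rw [← h_law t] at hi' ⊢
    exact (integral_map (hT t).aemeasurable hi').symm
  simp only [gprFunctional]
  have hsum : Integrable (fun ω => 1 / (2 * σn ^ 2) * ∑ t : Fin N, ‖R t ω - H (S t ω)‖ ^ 2) P :=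
    (integrable_finsetSum _ fun (t : Fin N) _ => hit t).const_mul _
  rw [integral_add (integrable_const _) hsum, integral_const, integral_const_mul,
    integral_finsetSum _ fun (t : Fin N) _ => hit t]
  simp [heq]

theorem inner_integral_smul {ρ : Measure (Vec d)} {φ : Vec d → ℝ} {F : Vec d → Vec m}
    (hφ : MemLp φ 2 ρ)
    (hF : MemLp F 2 ρ) (v : Vec m) (hφv : MemLp (fun x => φ x • v) 2 ρ) :
    inner ℝ v (∫ x, φ x • F x ∂ρ) = inner ℝ hφv.toLp hF.toLp := by
  have hint : Integrable (fun x => φ x • F x) ρ := memLp_one_iff_integrable.mp (hF.smul hφ)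
  rw [← integral_inner hint, L2.inner_def]
  refine integral_congr_ae ?_
  filter_upwards [hφv.coeFn_toLp, hF.coeFn_toLp] with x hx1 hx2
  rw [hx1, hx2, inner_smul_left, inner_smul_right, conj_trivial]

variable {ρ : Measure (Vec d)} [IsProbabilityMeasure ρ]

/-- The adjoint of the inclusion into `L²(ρ)` is the integral operator of the kernel, so it maps an
eigenfunction of that operator to a multiple of itself. -/
theorem rbfToLp_adjoint_eigenfunction {φ : Vec d → ℝ} {l : ℝ} {v : Vec m}
    (hφv : MemLp (fun x => φ x • v) 2 ρ)
    (heig : ∀ᵐ x ∂ρ, ∫ y, rbfKernel σ x y * φ y ∂ρ = l * φ x) :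
    rbfToLp ρ m σ ((rbfToLp ρ m σ).adjoint hφv.toLp) = l • hφv.toLp := by
  set G := (rbfToLp ρ m σ).adjoint hφv.toLp with hG
  have h1 : ∀ x, G x = (∫ y, rbfKernel σ x y * φ y ∂ρ) • v := fun x => by
    refine ext_inner_right ℝ fun w => ?_
    rw [← RKHS.inner_kerFun, hG, ContinuousLinearMap.adjoint_inner_left, inner_rbfToLp,
      inner_smul_left, conj_trivial, ← integral_mul_const]
    refine integral_congr_ae ?_
    filter_upwards [hφv.coeFn_toLp] with y hy
    rw [hy, rbfSpace_kerFun_apply, inner_smul_left, inner_smul_right, conj_trivial,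
      rbfKernel_comm σ y x]
    ring
  refine Lp.ext ?_
  filter_upwards [coeFn_rbfToLp (ρ := ρ) G, Lp.coeFn_smul l hφv.toLp, hφv.coeFn_toLp, heig]
    with x hx1 hx2 hx3 hx4
  rw [hx1, hx2, Pi.smul_apply, hx3, h1, hx4, smul_smul]

/-- The normal equation, tested with the adjoint of the inclusion applied to `φ v`, relates the
coefficients of the minimizer and of `u` along `φ`. -/
theorem integral_eigenfunction_minimizer {u : Vec d → Vec m} (hu : MemLp u 2 ρ) {c : ℝ} (hc : 0 < c)
    {H : RBFSpace d m σ}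
    (hH : ∀ G, inner ℝ H G + c * inner ℝ (rbfToLp ρ m σ H - hu.toLp) (rbfToLp ρ m σ G) = 0)
    {φ : Vec d → ℝ} {l : ℝ} (hφ : MemLp φ 2 ρ)
    (heig : ∀ᵐ x ∂ρ, ∫ y, rbfKernel σ x y * φ y ∂ρ = l * φ x) :
    ∫ x, φ x • H x ∂ρ = (l / (l + c⁻¹)) • ∫ x, φ x • u x ∂ρ := by
  refine ext_inner_left ℝ fun v => ?_
  have hφv : MemLp (fun x => φ x • v) 2 ρ := by
    refine hφ.of_le_mul (c := ‖v‖) (hφ.1.smul_const v) (ae_of_all _ fun x => ?_)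
    rw [norm_smul, mul_comm]
  rw [inner_smul_right, inner_integral_smul hφ (rbfSpace_memLp ρ H) v hφv,
    inner_integral_smul hφ hu v hφv]
  set Φ := hφv.toLp with hΦ
  change inner ℝ Φ (rbfToLp ρ m σ H) = _
  set G := (rbfToLp ρ m σ).adjoint Φ with hG
  have hTG : rbfToLp ρ m σ G = l • Φ := rbfToLp_adjoint_eigenfunction hφv heig
  have h1 : ‖G‖ ^ 2 = l * ‖Φ‖ ^ 2 := by
    rw [← real_inner_self_eq_norm_sq]
    conv_lhs => rw [hG]
    rw [ContinuousLinearMap.adjoint_inner_left, ← hG, hTG, inner_smul_right,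
      real_inner_self_eq_norm_sq]
  have h2 := hH G
  rw [hTG, hG, ContinuousLinearMap.adjoint_inner_right, inner_smul_right, inner_sub_left,
    real_inner_comm, real_inner_comm _ (MemLp.toLp u hu)] at h2
  rcases eq_or_ne Φ 0 with h0 | h0
  · rw [h0, inner_zero_left, inner_zero_left, mul_zero]
  -- the kernel is positive semidefinite, so `l` is nonnegative and the denominator is positive
  have hl : 0 ≤ l := by
    have h3 : 0 < ‖Φ‖ ^ 2 := by
      have := norm_pos_iff.mpr h0
      positivity
    by_contra! h4
    nlinarith [sq_nonneg ‖G‖, mul_pos (neg_pos.mpr h4) h3]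
  have h5 : 0 < l + c⁻¹ := by positivity
  rw [div_mul_eq_mul_div, eq_div_iff h5.ne']
  field_simp
  linarith

theorem tendsto_minimizer_error (hσ : 0 < σ) {u : Vec d → Vec m} (hu : MemLp u 2 ρ) {c : ℕ → ℝ}
    (hc0 : ∀ N, 0 ≤ c N) (hc : Tendsto c atTop atTop) {H : ℕ → RBFSpace d m σ}
    (hH : ∀ N G, inner ℝ (H N) G
      + c N * inner ℝ (rbfToLp ρ m σ (H N) - hu.toLp) (rbfToLp ρ m σ G) = 0) :
    Tendsto (fun N => ∫⁻ x, ‖H N x - u x‖ₑ ^ 2 ∂ρ) atTop (𝓝 0) := by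
  have h1 : ∀ N, ∫⁻ x, ‖H N x - u x‖ₑ ^ 2 ∂ρ
      = ENNReal.ofReal (‖hu.toLp - rbfToLp ρ m σ (H N)‖ ^ 2) := fun N => by
    rw [← lintegral_sub_rbfSpace hu]
    refine lintegral_congr fun x => ?_
    rw [← enorm_neg, neg_sub]
  rw [ENNReal.tendsto_nhds_zero]
  intro ε hε
  obtain ⟨g, hg⟩ := exists_rbfSpace_lintegral_lt (m := m) hσ hu hε
  rw [lintegral_sub_rbfSpace hu] at hg
  have hlim : Tendsto (fun N => ENNReal.ofReal (‖g‖ ^ 2 / c N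
      + ‖hu.toLp - rbfToLp ρ m σ g‖ ^ 2)) atTop
      (𝓝 (ENNReal.ofReal (0 + ‖hu.toLp - rbfToLp ρ m σ g‖ ^ 2))) :=
    ENNReal.tendsto_ofReal ((hc.const_div_atTop _).add tendsto_const_nhds)
  rw [zero_add] at hlim
  filter_upwards [hlim.eventually_lt_const hg, hc.eventually_gt_atTop 0] with N hN hcN
  rw [h1]
  refine le_trans (ENNReal.ofReal_le_ofReal ?_) hN.le
  have h2 := tikhonov_eq_add (rbfToLp ρ m σ) hu.toLp (hH N) g
  have h3 : c N * ‖hu.toLp - rbfToLp ρ m σ (H N)‖ ^ 2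
      ≤ ‖g‖ ^ 2 + c N * ‖hu.toLp - rbfToLp ρ m σ g‖ ^ 2 := by
    have h4 := mul_nonneg (hc0 N) (sq_nonneg ‖rbfToLp ρ m σ (g - H N)‖)
    linarith [sq_nonneg ‖H N‖, sq_nonneg ‖g - H N‖]
  rw [← sub_le_iff_le_add, le_div_iff₀ hcN]
  linarith

end Expected

theorem mainTheorem1 (d m : ℕ) (σ σn : ℝ) (hσ : 0 < σ) (hσn : 0 < σn)
    -- the law `μ` of the pairs `(δs, δr)`, with `E‖δr‖² < ∞`
    (μ : Measure (Vec d × Vec m)) [IsProbabilityMeasure μ]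
    (hR : MemLp Prod.snd 2 μ)
    -- the regression function `η(δs) = E[δr | δs]`
    (η : Vec d → Vec m) (hη : Measurable η)
    (hη_cond : (fun z => η z.1) =ᵐ[μ]
      μ[(Prod.snd : Vec d × Vec m → Vec m) |
        MeasurableSpace.comap (Prod.fst : Vec d × Vec m → Vec d) inferInstance])
    -- i.i.d. training pairs `(δs_t, δr_t)`, `t = 0, 1, 2, …`
    {Ω : Type*} [MeasurableSpace Ω] (P : Measure Ω) [IsProbabilityMeasure P]
    (S : ℕ → Ω → Vec d) (R : ℕ → Ω → Vec m)
    (hS_meas : ∀ t, Measurable (S t)) (hR_meas : ∀ t, Measurable (R t))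
    (h_law : ∀ t, P.map (fun ω => (S t ω, R t ω)) = μ)
    (h_indep : iIndepFun (fun t ω => (S t ω, R t ω)) P) :
    -- the kernel term of the prediction is the unique minimizer of `J` over the RKHS
    (∀ (N : ℕ) (s : Fin N → Vec d) (r : Fin N → Vec m), ∃ H : RBFSpace d m σ,
      (∀ x, H x = gprTerm σ σn s r x) ∧ IsUniqueMinimizer (gprFunctional σn s r) H) ∧
    -- it converges to `η` in mean square
    Tendsto (fun N : ℕ => ∫⁻ ω, ∫⁻ x,
        ‖gprTerm σ σn (fun t : Fin N => S t ω) (fun t : Fin N => R t ω) x - η x‖ₑ ^ 2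
          ∂(μ.map Prod.fst) ∂P) atTop (𝓝 0) ∧
    -- so does the full prediction, uniformly over bounded linear prior means `W`
    (MemLp Prod.fst 2 μ → ∀ C : ℝ,
      Tendsto (fun N : ℕ => ∫⁻ ω, ⨆ (W : Vec d →L[ℝ] Vec m) (_ : ‖W‖ ≤ C), ∫⁻ x,
        ‖gprMean σ σn W (fun t : Fin N => S t ω) (fun t : Fin N => R t ω) x - η x‖ₑ ^ 2
          ∂(μ.map Prod.fst) ∂P) atTop (𝓝 0)) ∧
    -- the expected functional `E[J]` has a unique minimizer, whose coefficients along the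
    -- eigenfunctions of the kernel are `λ / (λ + σₙ²/N)` times those of `η`, and which tends to `η`
    (∃ Hbar : ℕ → RBFSpace d m σ,
      (∀ N : ℕ, IsUniqueMinimizer (fun H : RBFSpace d m σ =>
        ∫ ω, gprFunctional σn (fun t : Fin N => S t ω) (fun t : Fin N => R t ω) H ∂P) (Hbar N)) ∧
      (∀ N : ℕ, 1 ≤ N → ∀ (φ : Vec d → ℝ) (l : ℝ), MemLp φ 2 (μ.map Prod.fst) →
        (∀ᵐ x ∂(μ.map Prod.fst), ∫ y, rbfKernel σ x y * φ y ∂(μ.map Prod.fst) = l * φ x) →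
        (∫ x, φ x • Hbar N x ∂(μ.map Prod.fst)) =
          (l / (l + σn ^ 2 / N)) • ∫ x, φ x • η x ∂(μ.map Prod.fst)) ∧
      Tendsto (fun N : ℕ => ∫⁻ x, ‖Hbar N x - η x‖ₑ ^ 2 ∂(μ.map Prod.fst)) atTop (𝓝 0)) := by
  have hρ : IsProbabilityMeasure (μ.map Prod.fst) :=
    Measure.isProbabilityMeasure_map measurable_fst.aemeasurable
  have hηLp := memLp_regression hR hη hη_cond
  have hc0 : ∀ N : ℕ, 0 ≤ (N : ℝ) / σn ^ 2 := fun N => by positivity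
  choose Hbar hHbar using fun N : ℕ => exists_tikhonov_normal_equation
    (rbfToLp (μ.map Prod.fst) m σ) (hηLp.toLp η) (hc0 N)
  refine ⟨fun N s r => ⟨gprFun σ σn s r, gprFun_apply s r, gprFun_isUniqueMinimizer hσn s r⟩,
    tendsto_gprTerm_regression hσ hσn hR hη hη_cond hS_meas hR_meas h_law h_indep,
    fun hS C => tendsto_gprMean_regression hσ hσn hR hη hη_cond hS_meas hR_meas h_law h_indep hS C,
    Hbar, fun N H hH => ?_, fun N hN φ l hφ heig => ?_, ?_⟩
  · simp only [integral_gprFunctional hR hS_meas hR_meas h_law,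
      integral_risk_eq hR hη hη_cond hηLp]
    have h1 := tikhonov_eq_add _ _ (hHbar N) H
    have h2 : 0 < ‖H - Hbar N‖ ^ 2 := by
      have := norm_pos_iff.mpr (sub_ne_zero.mpr hH)
      positivity
    have h3 := mul_nonneg (hc0 N) (sq_nonneg ‖rbfToLp (μ.map Prod.fst) m σ (H - Hbar N)‖)
    have h4 : ∀ a b : ℝ, 1 / (2 * σn ^ 2) * (N * (a + b))
        = 1 / 2 * (N / σn ^ 2 * a) + 1 / 2 * (N / σn ^ 2 * b) := fun a b => by
      field_simp
    rw [h4, h4]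
    linarith
  · have hN' : (0 : ℝ) < N := by exact_mod_cast hN
    have h := integral_eigenfunction_minimizer hηLp (c := (N : ℝ) / σn ^ 2) (by positivity)
      (hHbar N) hφ heig
    rwa [inv_div] at h
  · exact tendsto_minimizer_error hσ hηLp hc0
      (tendsto_natCast_atTop_atTop.atTop_div_const (by positivity)) hHbar
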